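/- Theorem 1.5. For a finite graph $G$ and $\lambda>0$ let $\Omega$ be the set of independent sets of $G$, and let $\pi(X)=\lambda^{|X|}/\sum_{Y\in\Omega}\lambda^{|Y|}$, $X\in\Omega$, be the hard-core Gibbs distribution at fugacity $\lambda$. One step of the Glauber dynamics at fugacity $\lambda$ from $X\in\Omega$ chooses a uniformly random vertex $v$, sets $X'=X\cup\{v\}$ with probability $\lambda/(1+\lambda)$ and $X'=X\setminus\{v\}$ with probability $1/(1+\lambda)$, and moves to $X'$ if $X'\in\Omega$ and stays at $X$ otherwise. Simulated annealing along fugacities $0=\lambda_0<\lambda_1<\dots<\lambda_k=\lambda$ with step counts $T_1,\dots,T_k$ starts at $Y_0=\emptyset$, obtains $Y_i$ from $Y_{i-1}$ by $T_i$ steps of the Glauber dynamics at fugacity $\lambda_i$ for $i=1,\dots,k$, and outputs $Y_k$. There are a randomized algorithm $\mathcal A$ (a program of a unit-cost random-access machine with exact real arithmetic and comparisons, adjacency queries to the input graph, uniformly random choices from $\{0,\dots,m-1\}$, and coins with a computed real bias) and a polynomial $p$ in three variables such that for every $\varepsilon>0$ there is $C>0$ such that for every $\delta>0$ the following holds. Let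 $G$ be a $\Delta$-regular graph on $n\ge 1$ vertices with $\operatorname{girth}(G)\ge 6$ (acyclic graphs having infinite girth) and $\Delta\ge C\log(n/\delta)$, and let $0<\lambda\le(1-\varepsilon)e/\Delta$. Then, on input $(G,\lambda,\delta,\varepsilon)$, $\mathcal A$ always halts within $p(n,1/\varepsilon,\log^+(1/\delta))$ steps, where $\log^+x=\max(0,\log x)$; it outputs an independent set of $G$ whose law is exactly that of the output of simulated annealing for some increasing sequence of fugacities from $0$ to $\lambda$ and some step counts; and the total variation distance $\frac12\sum_{X\in\Omega}|\Pr(\text{output}=X)-\pi(X)|$ between this law and $\pi$ is at most $\delta$. -/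

import Mathlib

/-! ### The hard-core model -/

namespace HardCore

section Model

variable {V : Type} [Fintype V] [DecidableEq V]

/-- The set `Ω` of independent sets of `G`. -/
def IndepSets (G : SimpleGraph V) : Type :=
  {X : Finset V // G.IsIndepSet (X : Set V)}

noncomputable instance instFintypeIndepSets (G : SimpleGraph V) : Fintype (IndepSets G) :=
  haveI : Finite (IndepSets G) := inferInstanceAs (Finite {_X : Finset V // _})
  Fintype.ofFinite _

/-- The empty independent set. -/
def emptySet (G : SimpleGraph V) : IndepSets G := ⟨∅, by simp⟩

/-- The partition function `Z(G, lam) = ∑_{X ∈ Ω} lam ^ |X|`. -/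
noncomputable def partitionFunction (G : SimpleGraph V) (lam : ℝ) : ℝ :=
  ∑ X : IndepSets G, lam ^ X.1.card

/-- The Gibbs distribution `π(X) = lam ^ |X| / Z` on the independent sets. -/
noncomputable def gibbs (G : SimpleGraph V) (lam : ℝ) (X : IndepSets G) : ℝ :=
  lam ^ X.1.card / partitionFunction G lam

/-- Total variation distance of two distributions on a finite set. -/
noncomputable def tvDist {Ω : Type} [Fintype Ω] (μ ν : Ω → ℝ) : ℝ :=
  (1 / 2) * ∑ x, |μ x - ν x|

/-- A coin that shows `true` with probability `p` (truncated to `[0, 1]`). -/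
noncomputable def coin (p : ℝ) : PMF Bool :=
  PMF.ofFintype
    (fun b => cond b (ENNReal.ofReal (min p 1)) (1 - ENNReal.ofReal (min p 1)))
    (by simp)

open scoped Classical in
/-- The update of `X` at the vertex `v`: try to insert `v` (if `b`) or to delete it
(otherwise), and keep `X` if the result is not independent. -/
noncomputable def update (G : SimpleGraph V) (X : IndepSets G) (v : V) (b : Bool) :
    IndepSets G :=
  if h : G.IsIndepSet ((if b then insert v X.1 else X.1.erase v : Finset V) : Set V)
  then ⟨_, h⟩ else X

variable [Nonempty V]

/-- One step of the Glauber dynamics at fugacity `lam`: a uniformly random vertex is inserted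
with probability `lam / (1 + lam)` and deleted with probability `1 / (1 + lam)`. -/
noncomputable def glauberStep (G : SimpleGraph V) (lam : ℝ) (X : IndepSets G) :
    PMF (IndepSets G) :=
  (PMF.uniformOfFintype V).bind fun v =>
    (coin (lam / (1 + lam))).map fun b => update G X v b

/-- `T` steps of the Glauber dynamics at fugacity `lam`, started at `X`. -/
noncomputable def glauber (G : SimpleGraph V) (lam : ℝ) : ℕ → IndepSets G → PMF (IndepSets G)
  | 0, X => PMF.pure X
  | T + 1, X => (glauberStep G lam X).bind (glauber G lam T)

/-- The law of the state `Y_k` reached by simulated annealing: `Y_0 = ∅`, and `Y_i` is reached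
from `Y_{i-1}` by `T i` steps of the Glauber dynamics at fugacity `lam i`. -/
noncomputable def annealing (G : SimpleGraph V) (lam : ℕ → ℝ) (T : ℕ → ℕ) :
    ℕ → PMF (IndepSets G)
  | 0 => PMF.pure (emptySet G)
  | i + 1 => (annealing G lam T i).bind (glauber G (lam (i + 1)) (T (i + 1)))

end Model

end HardCore

/-! ### Randomized algorithms: a real random-access machine with unit-cost steps -/

namespace RealRAM

/-- The store: registers holding natural numbers, registers holding real numbers, and a memory
of natural numbers that is addressed indirectly. -/
structure Store where
  nat : ℕ → ℕ
  real : ℕ → ℝ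
  mem : ℕ → ℕ

/-- Elementary instructions. The arguments are numbers of registers, except for the constant `c`
in `const`. -/
inductive Instr where
  | const (r c : ℕ)
  | add (r a b : ℕ)
  | sub (r a b : ℕ)
  | load (r a : ℕ)
  | store (a r : ℕ)
  | ofNat (r a : ℕ)
  | radd (r a b : ℕ)
  | rsub (r a b : ℕ)
  | rmul (r a b : ℕ)
  | rdiv (r a b : ℕ)
  | edge (r u v : ℕ)
  | flip (r p : ℕ)
  | unif (r m : ℕ)

/-- Tests: comparison of two registers. -/
inductive Test where
  | natLt (a b : ℕ)
  | realLt (a b : ℕ)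

/-- Programs. -/
inductive Prog where
  | skip
  | instr (i : Instr)
  | seq (p q : Prog)
  | ite (t : Test) (p q : Prog)
  | loop (t : Test) (p : Prog)

/-- Write `x` into the natural number register `r`. -/
def Store.setNat (s : Store) (r x : ℕ) : Store :=
  { s with nat := Function.update s.nat r x }

/-- Write `x` into the real register `r`. -/
def Store.setReal (s : Store) (r : ℕ) (x : ℝ) : Store :=
  { s with real := Function.update s.real r x }

/-- Write `x` into the memory cell `a`. -/
def Store.setMem (s : Store) (a x : ℕ) : Store :=
  { s with mem := Function.update s.mem a x }

/-- A uniformly random element of `{0, …, m - 1}` (and `0` if `m = 0`). -/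
noncomputable def uniformBelow (m : ℕ) : PMF ℕ :=
  if h : (Finset.range m).Nonempty then PMF.uniformOfFinset (Finset.range m) h else PMF.pure 0

/-- Truth value of a test. -/
def Test.holds (s : Store) : Test → Prop
  | .natLt a b => s.nat a < s.nat b
  | .realLt a b => s.real a < s.real b

open scoped Classical in
/-- Effect of an elementary instruction. The relation `E` is the adjacency relation of the input
graph, on vertices numbered from `0`. -/
noncomputable def Instr.exec (E : ℕ → ℕ → Prop) (s : Store) : Instr → PMF Store
  | .const r c => PMF.pure (s.setNat r c)
  | .add r a b => PMF.pure (s.setNat r (s.nat a + s.nat b))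
  | .sub r a b => PMF.pure (s.setNat r (s.nat a - s.nat b))
  | .load r a => PMF.pure (s.setNat r (s.mem (s.nat a)))
  | .store a r => PMF.pure (s.setMem (s.nat a) (s.nat r))
  | .ofNat r a => PMF.pure (s.setReal r (s.nat a))
  | .radd r a b => PMF.pure (s.setReal r (s.real a + s.real b))
  | .rsub r a b => PMF.pure (s.setReal r (s.real a - s.real b))
  | .rmul r a b => PMF.pure (s.setReal r (s.real a * s.real b))
  | .rdiv r a b => PMF.pure (s.setReal r (s.real a / s.real b))
  | .edge r u v => PMF.pure (s.setNat r (if E (s.nat u) (s.nat v) then 1 else 0))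
  | .flip r p => (HardCore.coin (s.real p)).map fun b => s.setNat r (if b then 1 else 0)
  | .unif r m => (uniformBelow (s.nat m)).map fun x => s.setNat r x

/-- A configuration: the list of programs still to be executed, and the store. The machine has
halted when the list is empty. -/
abbrev Config := List Prog × Store

open scoped Classical in
/-- One step of the machine. -/
noncomputable def step (E : ℕ → ℕ → Prop) : Config → PMF Config
  | ([], s) => PMF.pure ([], s)
  | (.skip :: K, s) => PMF.pure (K, s)
  | (.instr i :: K, s) => (i.exec E s).map fun s' => (K, s')
  | (.seq p q :: K, s) => PMF.pure (p :: q :: K, s)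
  | (.ite t p q :: K, s) => PMF.pure ((if t.holds s then p else q) :: K, s)
  | (.loop t p :: K, s) => PMF.pure (if t.holds s then p :: .loop t p :: K else K, s)

/-- Distribution of the configuration after `t` steps. -/
noncomputable def run (E : ℕ → ℕ → Prop) : ℕ → Config → PMF Config
  | 0, c => PMF.pure c
  | t + 1, c => (step E c).bind (run E t)

/-- The adjacency relation of a graph on `Fin n` as a relation on natural numbers. -/
def edges {n : ℕ} (G : SimpleGraph (Fin n)) (u v : ℕ) : Prop :=
  ∃ (hu : u < n) (hv : v < n), G.Adj ⟨u, hu⟩ ⟨v, hv⟩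

/-- The initial store: `n` is in the first natural number register, the inputs `x, y, z` are in
the first three real registers, and everything else is zero. -/
def initStore (n : ℕ) (x y z : ℝ) : Store where
  nat := fun r => if r = 0 then n else 0
  real := fun r => if r = 0 then x else if r = 1 then y else if r = 2 then z else 0
  mem := fun _ => 0

/-- The output of a halted machine: the set of the vertices `v` with `mem v ≠ 0`. There is no
output before the machine has halted. -/
def output (n : ℕ) : Config → Option (Finset (Fin n))
  | ([], s) => some (Finset.univ.filter fun v : Fin n => s.mem v ≠ 0)
  | (_ :: _, _) => none

/-- The distribution of the output of the program `P` after `t` steps, when the input is the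
graph `G` together with the real numbers `x, y, z`. -/
noncomputable def outputAfter (P : Prog) (t : ℕ) {n : ℕ} (G : SimpleGraph (Fin n))
    (x y z : ℝ) : PMF (Option (Finset (Fin n))) :=
  (run (edges G) t ([P], initStore n x y z)).map (output n)

end RealRAM

/-! Two copies of the Glauber dynamics are run with the same vertex and the same coin. A
disagreement at `v` can spread only to a neighbour `w` that is free in one of the two sets. That set
does not contain `v`, and `w` is counted there by `unblocked` at `v`. So if fugacity times
`unblocked` is at most `1 - ε / 4` at all vertices of both sets, the expected Hamming distance
contracts by `1 - ε / (4n)` (`card_mismatch_le`, `expect_couple_hamming_le`). This works for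
arbitrary pairs of such sets, so no path coupling is needed.

Under the Gibbs distribution the bound on `unblocked` fails only with probability exponentially
small in `Δ`. Given the configuration outside the children of `w`, these are childless with
probability `(1 + λ)^(-f)`, where `f` counts the free children. Girth at least 6 keeps the child
sets of different neighbours of `v` disjoint and nonadjacent, so `unblocked` concentrates around the
sum of these probabilities (`childless_mgf`, `expect_not_typical`). The maximum `M` and the minimum
`m` of `unblocked` then satisfy, up to small errors, `m ≥ Δ exp(-λM)` and `M ≤ Δ exp(-λm)`. With `c
= λΔ` and `y = λM` this reads `y ≤ c exp(-c exp(-y))`. For `c ≤ (1 - ε)e` the right side is smaller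
than `y`, by a uniform margin, as soon as `1 - ε / 4 ≤ y ≤ 3` (`two_step_lt`, `exists_gap`), which
forces `y ≤ 1 - ε / 4` (`unblocked_le_of_typical`).

Contraction holds only at typical pairs, so both copies must stay typical. Annealing secures this:
consecutive Gibbs distributions have density ratio at most 3, the dynamics preserves this
domination, and the second copy is stationary. Hence atypical states are rare at every time
(`testClose_glauber`), and the errors of the stages add up (`testClose_annealing`). The condition `Δ
≥ C log(n/δ)` absorbs the polynomial factors (`failure_le`).

The program finds the number of steps per stage without logarithms, by multiplying `6n²/δ` by the
contraction factor until the product is at most one. Its running time is deterministic, and its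
output law is computed exactly (`outputAfter_annealProg`). -/

namespace HardCore

/-! ### Expectations and total variation on finite types -/

section Expectation

variable {α β : Type} [Fintype α] [Fintype β]

/-- Expectation of a real function under a distribution on a finite type. -/
noncomputable def expect (μ : PMF α) (f : α → ℝ) : ℝ := ∑ x, (μ x).toReal * f x

lemma sum_toReal (μ : PMF α) : ∑ x, (μ x).toReal = 1 := by
  rw [← ENNReal.toReal_sum (fun x _ => μ.apply_ne_top x), ← tsum_fintype (L := .unconditional _),
    μ.tsum_coe, ENNReal.toReal_one]

lemma expect_pure (a : α) (f : α → ℝ) : expect (PMF.pure a) f = f a := by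
  classical
  unfold expect
  rw [Finset.sum_eq_single a]
  · simp
  · intro b _ hb
    simp [PMF.pure_apply, hb]
  · simp

lemma expect_bind (μ : PMF α) (κ : α → PMF β) (f : β → ℝ) :
    expect (μ.bind κ) f = expect μ fun x => expect (κ x) f := by
  unfold expect
  simp_rw [Finset.mul_sum]
  rw [Finset.sum_comm]
  refine Finset.sum_congr rfl fun y _ => ?_
  rw [PMF.bind_apply, tsum_fintype, ENNReal.toReal_sum
    (fun x _ => ENNReal.mul_ne_top (μ.apply_ne_top x) ((κ x).apply_ne_top y)), Finset.sum_mul]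
  refine Finset.sum_congr rfl fun x _ => ?_
  rw [ENNReal.toReal_mul, mul_assoc]

lemma expect_map (μ : PMF α) (g : α → β) (f : β → ℝ) :
    expect (μ.map g) f = expect μ fun x => f (g x) := by
  rw [← PMF.bind_pure_comp, expect_bind]
  simp [expect_pure]

lemma expect_mono (μ : PMF α) {f g : α → ℝ} (h : ∀ x, f x ≤ g x) : expect μ f ≤ expect μ g :=
  Finset.sum_le_sum fun x _ => mul_le_mul_of_nonneg_left (h x) ENNReal.toReal_nonneg

lemma expect_const (μ : PMF α) (c : ℝ) : expect μ (fun _ => c) = c := by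
  unfold expect
  rw [← Finset.sum_mul, sum_toReal, one_mul]

lemma expect_add (μ : PMF α) (f g : α → ℝ) :
    expect μ (fun x => f x + g x) = expect μ f + expect μ g := by
  simp [expect, mul_add, Finset.sum_add_distrib]

lemma expect_sub (μ : PMF α) (f g : α → ℝ) :
    expect μ (fun x => f x - g x) = expect μ f - expect μ g := by
  simp [expect, mul_sub, Finset.sum_sub_distrib]

lemma expect_mul_left (μ : PMF α) (c : ℝ) (f : α → ℝ) :
    expect μ (fun x => c * f x) = c * expect μ f := by
  unfold expect
  rw [Finset.mul_sum]
  exact Finset.sum_congr rfl fun x _ => by ring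

lemma expect_nonneg (μ : PMF α) {f : α → ℝ} (h : ∀ x, 0 ≤ f x) : 0 ≤ expect μ f :=
  Finset.sum_nonneg fun x _ => mul_nonneg ENNReal.toReal_nonneg (h x)

lemma expect_uniform [Nonempty α] (f : α → ℝ) :
    expect (PMF.uniformOfFintype α) f = (1 / (Fintype.card α : ℝ)) * ∑ x, f x := by
  unfold expect
  rw [Finset.mul_sum]
  exact Finset.sum_congr rfl fun x _ => by simp

lemma expect_coin {p : ℝ} (h0 : 0 ≤ p) (h1 : p ≤ 1) (f : Bool → ℝ) :
    expect (coin p) f = p * f true + (1 - p) * f false := by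
  unfold expect coin
  simp only [Fintype.sum_bool, PMF.ofFintype_apply, cond_true, cond_false, min_eq_left h1]
  rw [ENNReal.toReal_ofReal h0, ENNReal.toReal_sub_of_le (by simpa using h1) (by simp),
    ENNReal.toReal_ofReal h0, ENNReal.toReal_one]

/-- `μ` and `ν` differ by at most `d` on every test function with values in `[0, 1]`. -/
def TestClose (μ ν : PMF α) (d : ℝ) : Prop :=
  ∀ f : α → ℝ, (∀ x, 0 ≤ f x) → (∀ x, f x ≤ 1) → expect μ f - expect ν f ≤ d

lemma TestClose.bind {μ ν : PMF α} {d : ℝ} (h : TestClose μ ν d) (κ : α → PMF β) :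
    TestClose (μ.bind κ) (ν.bind κ) d := by
  intro f h0 h1
  rw [expect_bind, expect_bind]
  refine h _ (fun x => expect_nonneg _ h0) fun x => ?_
  rw [← expect_const (κ x) 1]
  exact expect_mono _ h1

lemma TestClose.trans {μ ν ρ : PMF α} {d e : ℝ} (h : TestClose μ ν d) (h' : TestClose ν ρ e) :
    TestClose μ ρ (d + e) := by
  intro f h0 h1
  linarith [h f h0 h1, h' f h0 h1]

/-- The optimal test is the indicator of `ν ≤ μ`. Since both masses are one, the positive part of `μ
- ν` carries half of the `ℓ¹` norm. -/
lemma TestClose.tvDist_le {μ ν : PMF α} {d : ℝ} (h : TestClose μ ν d) :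
    tvDist (fun x => (μ x).toReal) (fun x => (ν x).toReal) ≤ d := by
  classical
  have key := h (fun x => if (ν x).toReal ≤ (μ x).toReal then 1 else 0)
    (fun x => by split_ifs <;> norm_num)
    (fun x => by split_ifs <;> norm_num)
  have hs : ∑ x, ((μ x).toReal - (ν x).toReal) = 0 := by
    rw [Finset.sum_sub_distrib, sum_toReal, sum_toReal, sub_self]
  have e : ∑ x, |(μ x).toReal - (ν x).toReal| =
      ∑ x, (2 * ((μ x).toReal * (if (ν x).toReal ≤ (μ x).toReal then 1 else 0)
        - (ν x).toReal * (if (ν x).toReal ≤ (μ x).toReal then 1 else 0))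
        - ((μ x).toReal - (ν x).toReal)) := by
    refine Finset.sum_congr rfl fun x _ => ?_
    split_ifs with hx
    · rw [abs_of_nonneg (by linarith)]; ring
    · rw [abs_of_neg (by linarith)]; ring
  rw [Finset.sum_sub_distrib, hs, ← Finset.mul_sum, Finset.sum_sub_distrib] at e
  unfold tvDist
  unfold expect at key
  rw [e]
  linarith

lemma testClose_one (μ ν : PMF α) : TestClose μ ν 1 := by
  intro f h0 h1
  have a := expect_mono μ h1
  rw [expect_const] at a
  linarith [expect_nonneg ν h0]

end Expectation

/-! ### The single-vertex update -/

section Update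

variable {V : Type} [Fintype V] [DecidableEq V]

/-- A rejected insertion means that `v` has an occupied neighbour, so `v` was already unoccupied.
Hence the new state of `v` never depends on its old state. -/
lemma mem_update (G : SimpleGraph V) (X : IndepSets G) (v u : V) (b : Bool) :
    u ∈ (update G X v b).1 ↔
      if u = v then b = true ∧ ∀ w ∈ X.1, ¬ G.Adj v w else u ∈ X.1 := by
  obtain ⟨X, hX⟩ := X
  cases b with
  | false =>
    have h : G.IsIndepSet ((X.erase v : Finset V) : Set V) :=
      hX.mono (by simp)
    have e : update G ⟨X, hX⟩ v false = ⟨X.erase v, h⟩ := dif_pos h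
    rw [e]
    split_ifs with huv
    · simp [huv]
    · simp [huv]
  | true =>
    by_cases hf : ∀ w ∈ X, ¬ G.Adj v w
    · have h : G.IsIndepSet ((insert v X : Finset V) : Set V) := by
        intro a ha c hc hac
        simp only [Finset.coe_insert, Set.mem_insert_iff, Finset.mem_coe] at ha hc
        rcases ha with rfl | ha <;> rcases hc with rfl | hc
        · exact (hac rfl).elim
        · exact hf _ hc
        · exact fun hadj => hf _ ha hadj.symm
        · exact hX ha hc hac
      have e : update G ⟨X, hX⟩ v true = ⟨insert v X, h⟩ := dif_pos h
      rw [e]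
      split_ifs with huv
      · simp only [huv, Finset.mem_insert_self, true_and, true_iff]
        exact hf
      · simp [huv]
    · have h : ¬ G.IsIndepSet ((insert v X : Finset V) : Set V) := by
        intro h
        apply hf
        intro w hw hadj
        exact h (by simp) (by simp [hw]) hadj.ne hadj
      have e : update G ⟨X, hX⟩ v true = ⟨X, hX⟩ := dif_neg h
      rw [e]
      split_ifs with huv
      · subst huv
        simp only [true_and]
        refine iff_of_false (fun hu => hf fun w hw hadj => ?_) hf
        exact hX hu hw hadj.ne hadj
      · rfl

end Update

end HardCore

namespace HardCore

/-! ### Gibbs distribution: two-round sampling, warm starts, stationarity -/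

section Gibbs

variable {V : Type} [Fintype V] [DecidableEq V] (G : SimpleGraph V)

/-- The vertex `w` has no neighbour in `X`. -/
def Free (X : Finset V) (w : V) : Prop := ∀ u ∈ X, ¬ G.Adj w u

open scoped Classical in
/-- Sum over the independent sets. -/
noncomputable def indepSum (f : Finset V → ℝ) : ℝ :=
  ∑ X ∈ Finset.univ.filter (fun X : Finset V => G.IsIndepSet (X : Set V)), f X

variable {G}

lemma indepSum_eq (f : Finset V → ℝ) : indepSum G f = ∑ X : IndepSets G, f X.1 := by
  classical
  unfold indepSum
  symm
  refine Finset.sum_bij (fun X _ => X.1) (fun X _ => by simpa using X.2)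
    (fun X _ Y _ h => Subtype.ext h) (fun X hX => ⟨⟨X, by simpa using hX⟩, Finset.mem_univ _, rfl⟩)
    (fun _ _ => rfl)

lemma indepSum_mono {f g : Finset V → ℝ}
    (h : ∀ X : Finset V, G.IsIndepSet (X : Set V) → f X ≤ g X) : indepSum G f ≤ indepSum G g := by
  classical
  exact Finset.sum_le_sum fun X hX => h X (by simpa using hX)

lemma indepSum_congr {f g : Finset V → ℝ}
    (h : ∀ X : Finset V, G.IsIndepSet (X : Set V) → f X = g X) : indepSum G f = indepSum G g :=
  le_antisymm (indepSum_mono fun X hX => (h X hX).le) (indepSum_mono fun X hX => (h X hX).ge)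

lemma isIndepSet_union {Y R : Finset V} (hY : G.IsIndepSet (Y : Set V))
    (hR : G.IsIndepSet (R : Set V)) (h : ∀ x ∈ R, Free G Y x) :
    G.IsIndepSet ((Y ∪ R : Finset V) : Set V) := by
  intro a ha b hb hab
  simp only [Finset.coe_union, Set.mem_union, Finset.mem_coe] at ha hb
  rcases ha with ha | ha <;> rcases hb with hb | hb
  · exact hY ha hb hab
  · exact fun hadj => h b hb a ha hadj.symm
  · exact h a ha b hb
  · exact hR ha hb hab

open scoped Classical in
/-- Independent sets are chosen in two rounds: first outside an independent set `S`, and then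
among the vertices of `S` that are still free. -/
lemma indepSum_split {S : Finset V} (hS : G.IsIndepSet (S : Set V)) (f : Finset V → ℝ) :
    indepSum G f = indepSum G fun Y =>
      if Disjoint Y S then ∑ R ∈ (S.filter (Free G Y)).powerset, f (Y ∪ R) else 0 := by
  unfold indepSum
  rw [← Finset.sum_filter, Finset.filter_filter, Finset.sum_sigma']
  refine Finset.sum_bij' (fun X _ => ⟨X \ S, X ∩ S⟩) (fun p _ => p.1 ∪ p.2) ?_ ?_ ?_ ?_ ?_
  · intro X hX
    have hX : G.IsIndepSet (X : Set V) := by simpa using hX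
    simp only [Finset.mem_sigma, Finset.mem_filter, Finset.mem_univ, true_and,
      Finset.mem_powerset]
    refine ⟨⟨hX.mono (by simp), Finset.sdiff_disjoint⟩, ?_⟩
    intro x hx
    simp only [Finset.mem_inter] at hx
    simp only [Finset.mem_filter]
    refine ⟨hx.2, fun u hu hadj => ?_⟩
    simp only [Finset.mem_sdiff] at hu
    exact hX hx.1 hu.1 hadj.ne hadj
  · rintro ⟨Y, R⟩ hp
    simp only [Finset.mem_sigma, Finset.mem_filter, Finset.mem_univ, true_and,
      Finset.mem_powerset] at hp
    obtain ⟨⟨hY, _⟩, hR⟩ := hp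
    simp only [Finset.mem_filter, Finset.mem_univ, true_and]
    refine isIndepSet_union hY (hS.mono ?_) ?_
    · exact fun x hx => (Finset.mem_filter.mp (hR hx)).1
    · exact fun x hx => (Finset.mem_filter.mp (hR hx)).2
  · intro X _
    exact Finset.sdiff_union_inter X S
  · rintro ⟨Y, R⟩ hp
    simp only [Finset.mem_sigma, Finset.mem_filter, Finset.mem_univ, true_and,
      Finset.mem_powerset] at hp
    obtain ⟨⟨_, hYS⟩, hR⟩ := hp
    have hRS : R ⊆ S := hR.trans (Finset.filter_subset _ _)
    have h1 : (Y ∪ R) \ S = Y := by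
      ext x
      have : x ∈ Y → x ∉ S := fun hx => Finset.disjoint_left.mp hYS hx
      have := @hRS x
      simp only [Finset.mem_sdiff, Finset.mem_union]
      tauto
    have h2 : (Y ∪ R) ∩ S = R := by
      ext x
      have : x ∈ Y → x ∉ S := fun hx => Finset.disjoint_left.mp hYS hx
      have := @hRS x
      simp only [Finset.mem_inter, Finset.mem_union]
      tauto
    simp only [h1, h2]
  · intro X _
    rw [Finset.sdiff_union_inter]

lemma card_union_of_disjoint {Y S R : Finset V} (h : Disjoint Y S) (hR : R ⊆ S) :
    (Y ∪ R).card = Y.card + R.card :=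
  Finset.card_union_of_disjoint (h.mono_right hR)

lemma sum_powerset_pow (U : Finset V) (x : ℝ) :
    ∑ R ∈ U.powerset, x ^ R.card = (1 + x) ^ U.card := by
  have := Finset.sum_pow_mul_eq_add_pow x 1 U
  simp only [one_pow, mul_one] at this
  rw [this, add_comm]

open scoped Classical in
/-- A bound for the conditional expectation of `g` given the set outside `S` yields a bound for
the expectation of `F * g`, if `F` does not depend on the set inside `S`. -/
lemma indepSum_mul_le {S : Finset V} (hS : G.IsIndepSet (S : Set V)) {lam K : ℝ} (hlam : 0 ≤ lam)
    {F g : Finset V → ℝ} (hF₀ : ∀ X, 0 ≤ F X)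
    (hF : ∀ Y R, R ⊆ S → F (Y ∪ R) = F Y)
    (hg : ∀ Y : Finset V, Disjoint Y S →
      ∑ R ∈ (S.filter (Free G Y)).powerset, lam ^ R.card * g (Y ∪ R) ≤
        K * (1 + lam) ^ (S.filter (Free G Y)).card) :
    indepSum G (fun X => lam ^ X.card * (F X * g X)) ≤
      K * indepSum G (fun X => lam ^ X.card * F X) := by
  rw [indepSum_split hS, indepSum_split hS (fun X => lam ^ X.card * F X)]
  conv_rhs => unfold indepSum
  rw [Finset.mul_sum]
  refine indepSum_mono fun Y _ => ?_
  by_cases hYS : Disjoint Y S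
  · simp only [if_pos hYS]
    have e1 : ∑ R ∈ (S.filter (Free G Y)).powerset,
        lam ^ (Y ∪ R).card * (F (Y ∪ R) * g (Y ∪ R)) =
        lam ^ Y.card * F Y * ∑ R ∈ (S.filter (Free G Y)).powerset, lam ^ R.card * g (Y ∪ R) := by
      rw [Finset.mul_sum]
      refine Finset.sum_congr rfl fun R hR => ?_
      have hRS := (Finset.mem_powerset.mp hR).trans (Finset.filter_subset _ _)
      rw [card_union_of_disjoint hYS hRS, hF Y R hRS, pow_add]
      ring
    have e2 : ∑ R ∈ (S.filter (Free G Y)).powerset, lam ^ (Y ∪ R).card * F (Y ∪ R) =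
        lam ^ Y.card * F Y * (1 + lam) ^ (S.filter (Free G Y)).card := by
      rw [← sum_powerset_pow, Finset.mul_sum]
      refine Finset.sum_congr rfl fun R hR => ?_
      have hRS := (Finset.mem_powerset.mp hR).trans (Finset.filter_subset _ _)
      rw [card_union_of_disjoint hYS hRS, hF Y R hRS, pow_add]
      ring
    rw [e1, e2]
    calc _ ≤ lam ^ Y.card * F Y * (K * (1 + lam) ^ (S.filter (Free G Y)).card) :=
          mul_le_mul_of_nonneg_left (hg Y hYS) (mul_nonneg (pow_nonneg hlam _) (hF₀ Y))
      _ = _ := by ring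
  · simp [hYS]

lemma partitionFunction_eq (lam : ℝ) :
    partitionFunction G lam = indepSum G fun X => lam ^ X.card := by
  rw [indepSum_eq]; rfl

lemma partitionFunction_pos {lam : ℝ} (h : 0 ≤ lam) : 0 < partitionFunction G lam := by
  unfold partitionFunction
  refine Finset.sum_pos' (fun X _ => pow_nonneg h _) ⟨emptySet G, Finset.mem_univ _, ?_⟩
  simp [emptySet]

variable (G) in
/-- The Gibbs distribution as a probability mass function. -/
noncomputable def gibbsPMF (lam : ℝ) (h : 0 ≤ lam) : PMF (IndepSets G) :=
  PMF.ofFintype (fun X => ENNReal.ofReal (gibbs G lam X)) (by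
    rw [← ENNReal.ofReal_sum_of_nonneg (f := gibbs G lam)
      (fun X _ => div_nonneg (pow_nonneg h _) (partitionFunction_pos h).le)]
    unfold gibbs
    rw [← Finset.sum_div, ← partitionFunction, div_self (partitionFunction_pos h).ne',
      ENNReal.ofReal_one])

lemma gibbsPMF_toReal {lam : ℝ} (h : 0 ≤ lam) (X : IndepSets G) :
    (gibbsPMF G lam h X).toReal = gibbs G lam X :=
  ENNReal.toReal_ofReal (div_nonneg (pow_nonneg h _) (partitionFunction_pos h).le)

lemma expect_gibbs {lam : ℝ} (h : 0 ≤ lam) (f : IndepSets G → ℝ) :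
    expect (gibbsPMF G lam h) f =
      (∑ X : IndepSets G, lam ^ X.1.card * f X) / partitionFunction G lam := by
  unfold expect
  rw [Finset.sum_div]
  refine Finset.sum_congr rfl fun X _ => ?_
  rw [gibbsPMF_toReal, gibbs]
  ring

/-- Expand `(lam + h)^|Y|` over subsets `S ⊆ Y`. Each `S` is again independent, and for fixed `S`
the sets `Y \ S` are distinct subsets of `V`, of total weight at most `(1 + h)^|V|`. -/
lemma partitionFunction_add_le {lam h : ℝ} (hlam : 0 ≤ lam) (hh : 0 ≤ h) :
    partitionFunction G (lam + h) ≤ (1 + h) ^ Fintype.card V * partitionFunction G lam := by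
  classical
  rw [partitionFunction_eq, partitionFunction_eq]
  unfold indepSum
  rw [Finset.mul_sum]
  calc _ = ∑ Y ∈ Finset.univ.filter (fun X : Finset V => G.IsIndepSet (X : Set V)),
        ∑ S ∈ Y.powerset, lam ^ S.card * h ^ (Y \ S).card := by
        refine Finset.sum_congr rfl fun Y _ => ?_
        simp only [← Finset.sum_pow_mul_eq_add_pow]
        refine Finset.sum_congr rfl fun S hS => ?_
        rw [Finset.card_sdiff_of_subset (Finset.mem_powerset.mp hS)]
    _ = ∑ S ∈ Finset.univ.filter (fun X : Finset V => G.IsIndepSet (X : Set V)),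
        ∑ Y ∈ Finset.univ.filter (fun X : Finset V => G.IsIndepSet (X : Set V) ∧ S ⊆ X),
          lam ^ S.card * h ^ (Y \ S).card := by
        refine Finset.sum_comm' fun Y S => ?_
        simp only [Finset.mem_filter, Finset.mem_univ, true_and, Finset.mem_powerset]
        constructor
        · rintro ⟨h1, h2⟩
          exact ⟨⟨h1, h2⟩, h1.mono (by exact_mod_cast h2)⟩
        · rintro ⟨⟨h1, h2⟩, _⟩
          exact ⟨h1, h2⟩
    _ ≤ _ := by
        refine Finset.sum_le_sum fun S _ => ?_
        rw [← Finset.mul_sum, mul_comm]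
        refine mul_le_mul_of_nonneg_right ?_ (pow_nonneg hlam _)
        rw [← Finset.card_univ, ← sum_powerset_pow, ← Finset.sum_image
          (f := fun D : Finset V => h ^ D.card) (g := fun Y => Y \ S)]
        · refine Finset.sum_le_sum_of_subset_of_nonneg (fun D _ => by simp)
            fun D _ _ => pow_nonneg hh _
        · intro Y hY Y' hY' he
          simp only [Finset.coe_filter, Finset.mem_univ, true_and, Set.mem_ofPred_eq] at hY hY'
          rw [← Finset.sdiff_union_of_subset hY.2, ← Finset.sdiff_union_of_subset hY'.2]
          exact congrArg (· ∪ S) he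

/-- The Gibbs distribution at a slightly smaller fugacity is a warm start. -/
lemma expect_gibbs_le {lam lam' : ℝ} (h : 0 ≤ lam) (hle : lam ≤ lam')
    (hd : (lam' - lam) * Fintype.card V ≤ 1) {f : IndepSets G → ℝ} (hf : ∀ X, 0 ≤ f X) :
    expect (gibbsPMF G lam h) f ≤ 3 * expect (gibbsPMF G lam' (h.trans hle)) f := by
  have hK : (1 + (lam' - lam)) ^ Fintype.card V ≤ 3 := by
    calc (1 + (lam' - lam)) ^ Fintype.card V
        ≤ Real.exp (lam' - lam) ^ Fintype.card V :=
          pow_le_pow_left₀ (by linarith) (by linarith [Real.add_one_le_exp (lam' - lam)]) _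
      _ = Real.exp ((lam' - lam) * Fintype.card V) := by rw [← Real.exp_nat_mul, mul_comm]
      _ ≤ Real.exp 1 := Real.exp_le_exp.mpr hd
      _ ≤ 3 := by linarith [Real.exp_one_lt_d9]
  have hZ := partitionFunction_add_le (G := G) h (sub_nonneg.mpr hle)
  rw [add_sub_cancel] at hZ
  have hp := partitionFunction_pos (G := G) h
  have hp' := partitionFunction_pos (G := G) (h.trans hle)
  have hZ' : partitionFunction G lam' ≤ 3 * partitionFunction G lam :=
    hZ.trans (mul_le_mul_of_nonneg_right hK hp.le)
  rw [expect_gibbs, expect_gibbs, ← mul_div_assoc, div_le_div_iff₀ hp hp']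
  -- The unnormalised weights only grow with the fugacity, so the whole loss comes from the ratio of
  -- the partition functions.
  have hs : ∑ X : IndepSets G, lam ^ X.1.card * f X ≤ ∑ X : IndepSets G, lam' ^ X.1.card * f X :=
    Finset.sum_le_sum fun X _ => mul_le_mul_of_nonneg_right (pow_le_pow_left₀ h hle _) (hf X)
  have hs' : 0 ≤ ∑ X : IndepSets G, lam' ^ X.1.card * f X :=
    Finset.sum_nonneg fun X _ => mul_nonneg (pow_nonneg (h.trans hle) _) (hf X)
  nlinarith [mul_le_mul hs hZ' hp'.le hs']

lemma expect_glauberStep [Nonempty V] {lam : ℝ} (h : 0 ≤ lam) (X : IndepSets G)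
    (f : IndepSets G → ℝ) :
    expect (glauberStep G lam X) f = (1 / (Fintype.card V : ℝ)) * ∑ v,
      (lam / (1 + lam) * f (update G X v true) + 1 / (1 + lam) * f (update G X v false)) := by
  unfold glauberStep
  rw [expect_bind, expect_uniform]
  congr 1
  refine Finset.sum_congr rfl fun v _ => ?_
  have h1 : 0 < 1 + lam := by linarith
  rw [expect_map, expect_coin (by positivity) ((div_le_one h1).mpr (by linarith))]
  congr 2
  field_simp
  ring

open scoped Classical in
lemma update_true_val (X : IndepSets G) (v : V) :
    (update G X v true).1 = if Free G X.1 v then insert v X.1 else X.1.erase v := by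
  ext u
  rw [mem_update]
  by_cases hf : Free G X.1 v
  · have hf' : ∀ w ∈ X.1, ¬ G.Adj v w := hf
    rw [if_pos hf]
    by_cases huv : u = v
    · simp only [huv, if_true, true_and, Finset.mem_insert_self, iff_true]
      exact hf'
    · simp [huv]
  · have hf' : ¬ ∀ w ∈ X.1, ¬ G.Adj v w := hf
    rw [if_neg hf]
    by_cases huv : u = v
    · simp only [huv, if_true, true_and, Finset.notMem_erase, iff_false]
      exact hf'
    · simp [huv]

lemma update_false_val (X : IndepSets G) (v : V) :
    (update G X v false).1 = X.1.erase v := by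
  ext u
  rw [mem_update]
  by_cases huv : u = v <;> simp [huv]

/-- Stationarity holds vertex by vertex: the update resamples `v` from its conditional law given the
rest. Splitting along `S = {v}` leaves two configurations if `v` is free and one if it is blocked.
-/
lemma sum_update {lam : ℝ} (h : 0 ≤ lam) (v : V) (f : IndepSets G → ℝ) :
    ∑ X : IndepSets G, lam ^ X.1.card * (lam / (1 + lam) * f (update G X v true) +
      1 / (1 + lam) * f (update G X v false)) = ∑ X : IndepSets G, lam ^ X.1.card * f X := by
  classical
  set F : Finset V → ℝ := fun X => if h : G.IsIndepSet (X : Set V) then f ⟨X, h⟩ else 0 with hFdef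
  have hF : ∀ X : IndepSets G, f X = F X.1 := fun X => by
    simp only [hFdef]; rw [dif_pos X.2]; rfl
  simp only [hF, update_true_val, update_false_val]
  rw [← indepSum_eq (fun X => lam ^ X.card * (lam / (1 + lam) *
      F (if Free G X v then insert v X else X.erase v) + 1 / (1 + lam) * F (X.erase v))),
    ← indepSum_eq (fun X => lam ^ X.card * F X)]
  have hS : G.IsIndepSet (({v} : Finset V) : Set V) := by simp
  rw [indepSum_split hS, indepSum_split hS (fun X => lam ^ X.card * F X)]
  refine indepSum_congr fun Y _ => ?_
  by_cases hY : Disjoint Y {v}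
  · have hv : v ∉ Y := Finset.disjoint_singleton_right.mp hY
    have h1 : (1 + lam) ≠ 0 := by linarith
    by_cases hf : Free G Y v
    · have hfilt : ({v} : Finset V).filter (Free G Y) = {v} := by
        rw [Finset.filter_singleton, if_pos hf]
      have hfree : Free G (Y ∪ {v}) v := by
        intro u hu
        simp only [Finset.mem_union, Finset.mem_singleton] at hu
        rcases hu with hu | rfl
        · exact hf u hu
        · exact G.loopless.irrefl _
      have ei : insert v (Y ∪ {v}) = Y ∪ {v} := by simp
      have ei' : insert v Y = Y ∪ {v} := by rw [Finset.union_comm]; rfl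
      have ee : (Y ∪ {v}).erase v = Y := by
        rw [← ei', Finset.erase_insert hv]
      have ec : (Y ∪ {v}).card = Y.card + 1 := by
        rw [← ei', Finset.card_insert_of_notMem hv]
      rw [if_pos hY, if_pos hY, hfilt, ← insert_empty_eq v, Finset.sum_powerset_insert (by simp),
        Finset.sum_powerset_insert (by simp)]
      simp only [Finset.powerset_empty, Finset.sum_singleton, Finset.union_empty,
        insert_empty_eq, if_pos hf, if_pos hfree, ei, ei', ee, ec, Finset.erase_eq_of_notMem hv]
      field_simp
      ring
    · have hfilt : ({v} : Finset V).filter (Free G Y) = ∅ := by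
        rw [Finset.filter_singleton, if_neg hf]
      rw [if_pos hY, if_pos hY, hfilt]
      simp only [Finset.powerset_empty, Finset.sum_singleton, Finset.union_empty, if_neg hf,
        Finset.erase_eq_of_notMem hv]
      field_simp
      ring
  · simp [hY]

/-- The Gibbs distribution is stationary. -/
lemma expect_gibbs_glauberStep [Nonempty V] {lam : ℝ} (h : 0 ≤ lam) (f : IndepSets G → ℝ) :
    expect (gibbsPMF G lam h) (fun X => expect (glauberStep G lam X) f) =
      expect (gibbsPMF G lam h) f := by
  rw [expect_gibbs, expect_gibbs]
  congr 1
  simp_rw [expect_glauberStep h, Finset.mul_sum]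
  rw [Finset.sum_comm]
  have hc : (Fintype.card V : ℝ) ≠ 0 := by exact_mod_cast Fintype.card_ne_zero
  calc _ = ∑ v : V, 1 / (Fintype.card V : ℝ) * ∑ X : IndepSets G, lam ^ X.1.card * f X := by
        refine Finset.sum_congr rfl fun v _ => ?_
        rw [← sum_update h v f, Finset.mul_sum]
        exact Finset.sum_congr rfl fun X _ => mul_left_comm _ _ _
    _ = _ := by
        rw [Finset.sum_const, Finset.card_univ, nsmul_eq_mul]
        field_simp

end Gibbs

end HardCore

namespace HardCore

/-! ### Excluding cycles of length 3, 4 and 5 -/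

section Girth

variable {V : Type} {G : SimpleGraph V}

lemma no_triangle (hg : 6 ≤ G.egirth) {a b c : V} (hab : G.Adj a b) (hbc : G.Adj b c)
    (hca : G.Adj c a) : False := by
  have h := SimpleGraph.le_egirth.mp hg a (.cons hab (.cons hbc (.cons hca .nil))) (by
    simp [SimpleGraph.Walk.cons_isCycle_iff, hab.ne, hbc.ne, hca.ne, hab.ne', hbc.ne', hca.ne'])
  norm_num at h

lemma no_quadrangle (hg : 6 ≤ G.egirth) {a b c d : V} (hab : G.Adj a b) (hbc : G.Adj b c)
    (hcd : G.Adj c d) (hda : G.Adj d a) (hac : a ≠ c) (hbd : b ≠ d) : False := by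
  have h := SimpleGraph.le_egirth.mp hg a (.cons hab (.cons hbc (.cons hcd (.cons hda .nil)))) (by
    simp [SimpleGraph.Walk.cons_isCycle_iff, hab.ne, hbc.ne, hcd.ne, hda.ne, hab.ne', hbc.ne',
      hcd.ne', hda.ne', hac, hbd, hac.symm, hbd.symm])
  norm_num at h

/-- Distinctness is automatic: if two vertices of the closed walk coincide, three of its edges form
a triangle. -/
lemma no_pentagon (hg : 6 ≤ G.egirth) {a b c d e : V} (hab : G.Adj a b) (hbc : G.Adj b c)
    (hcd : G.Adj c d) (hde : G.Adj d e) (hea : G.Adj e a) : False := by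
  have hac : a ≠ c := by rintro rfl; exact no_triangle hg hcd hde hea
  have hbd : b ≠ d := by rintro rfl; exact no_triangle hg hde hea hab
  have hce : c ≠ e := by rintro rfl; exact no_triangle hg hea hab hbc
  have hda : d ≠ a := by rintro rfl; exact no_triangle hg hab hbc hcd
  have heb : e ≠ b := by rintro rfl; exact no_triangle hg hbc hcd hde
  have h := SimpleGraph.le_egirth.mp hg a
    (.cons hab (.cons hbc (.cons hcd (.cons hde (.cons hea .nil))))) (by
    simp [SimpleGraph.Walk.cons_isCycle_iff, hab.ne, hbc.ne, hcd.ne, hde.ne, hea.ne, hab.ne',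
      hbc.ne', hcd.ne', hde.ne', hea.ne', hac, hbd, hce, hda, heb, hac.symm, hbd.symm, hce.symm,
      hda.symm, heb.symm])
  norm_num at h

end Girth

/-! ### Concentration of the local statistics -/

section Concentration

variable {V : Type} [Fintype V] [DecidableEq V] (G : SimpleGraph V) [DecidableRel G.Adj]

/-- The neighbours of `w` other than `v`. -/
def children (v w : V) : Finset V := (G.neighborFinset w).erase v

open scoped Classical in
/-- The number of neighbours of `v` that are not blocked by a vertex other than `v`. -/
noncomputable def unblocked (X : Finset V) (v : V) : ℕ :=
  ((G.neighborFinset v).filter fun w => Disjoint X (children G v w)).card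

open scoped Classical in
/-- Indicator of the event that no child of `w` is occupied. -/
noncomputable def childless (v w : V) (X : Finset V) : ℝ :=
  if Disjoint X (children G v w) then 1 else 0

open scoped Classical in
/-- The number of free children of `w`. -/
noncomputable def freeChildren (v w : V) (X : Finset V) : ℕ :=
  ((children G v w).filter (Free G X)).card

/-- Conditional probability that no child of `w` is occupied. -/
noncomputable def childlessProb (lam : ℝ) (v w : V) (X : Finset V) : ℝ :=
  ((1 + lam) ^ freeChildren G v w X)⁻¹

variable {G}

lemma mem_children {v w x : V} : x ∈ children G v w ↔ x ≠ v ∧ G.Adj w x := by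
  simp [children]

lemma childlessProb_nonneg {lam : ℝ} (h : 0 ≤ lam) (v w : V) (X : Finset V) :
    0 ≤ childlessProb G lam v w X := by unfold childlessProb; positivity

lemma childlessProb_le_one {lam : ℝ} (h : 0 ≤ lam) (v w : V) (X : Finset V) :
    childlessProb G lam v w X ≤ 1 :=
  inv_le_one_of_one_le₀ (one_le_pow₀ (by linarith))

lemma free_union_iff {Y R : Finset V} {x : V} (h : ∀ u ∈ R, ¬ G.Adj x u) :
    Free G (Y ∪ R) x ↔ Free G Y x := by
  constructor
  · exact fun hf u hu => hf u (Finset.mem_union_left _ hu)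
  · intro hf u hu
    rcases Finset.mem_union.mp hu with hu | hu
    · exact hf u hu
    · exact h u hu

lemma freeChildren_union {v w : V} {Y R : Finset V}
    (h : ∀ x ∈ children G v w, ∀ u ∈ R, ¬ G.Adj x u) :
    freeChildren G v w (Y ∪ R) = freeChildren G v w Y := by
  classical
  unfold freeChildren
  congr 1
  exact Finset.filter_congr fun x hx => free_union_iff (h x hx)

lemma isIndepSet_children (hg : 6 ≤ G.egirth) (v w : V) :
    G.IsIndepSet (children G v w : Set V) := by
  intro x hx y hy _ hadj
  exact no_triangle hg (mem_children.mp hx).2 hadj (mem_children.mp hy).2.symm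

/-- For a centred Bernoulli variable, `exp x ≤ 1 + x + x²` on `[-1, 1]` leaves only the variance
term, which is at most `θ²`. -/
lemma two_point_mgf {p θ : ℝ} (h0 : 0 ≤ p) (h1 : p ≤ 1) (hθ : |θ| ≤ 1) :
    p * Real.exp (θ * (1 - p)) + (1 - p) * Real.exp (θ * (0 - p)) ≤ Real.exp (θ ^ 2) := by
  have key : ∀ x : ℝ, |x| ≤ 1 → Real.exp x ≤ 1 + x + x ^ 2 := fun x hx => by
    have := (abs_le.mp (Real.abs_exp_sub_one_sub_id_le hx)).2
    linarith
  have b1 : |θ * (1 - p)| ≤ 1 := by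
    rw [abs_mul, abs_of_nonneg (by linarith : (0 : ℝ) ≤ 1 - p)]
    nlinarith [abs_nonneg θ]
  have b2 : |θ * (0 - p)| ≤ 1 := by
    rw [abs_mul, zero_sub, abs_neg, abs_of_nonneg h0]
    nlinarith [abs_nonneg θ]
  have k1 := mul_le_mul_of_nonneg_left (key _ b1) h0
  have k2 := mul_le_mul_of_nonneg_left (key _ b2) (by linarith : (0 : ℝ) ≤ 1 - p)
  have k3 := Real.add_one_le_exp (θ ^ 2)
  have hpp : p * (1 - p) ≤ 1 := by nlinarith
  have k4 : θ ^ 2 * (p * (1 - p)) ≤ θ ^ 2 := by nlinarith [sq_nonneg θ]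
  nlinarith

/-- Moment generating function of the number of childless neighbours, centred at the sum of the
conditional probabilities. -/
lemma childless_mgf (hg : 6 ≤ G.egirth) {lam θ : ℝ} (hlam : 0 ≤ lam) (hθ : |θ| ≤ 1) (v : V)
    (W : Finset V) (hW : W ⊆ G.neighborFinset v) :
    indepSum G (fun X => lam ^ X.card *
      Real.exp (θ * ∑ w ∈ W, (childless G v w X - childlessProb G lam v w X))) ≤
      Real.exp (θ ^ 2) ^ W.card * partitionFunction G lam := by
  classical
  induction W using Finset.induction_on with
  | empty => simp [partitionFunction_eq]
  | insert w W hw ih =>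
    have hvw : G.Adj v w := by simpa using hW (Finset.mem_insert_self w W)
    have step := indepSum_mul_le (isIndepSet_children hg v w) (K := Real.exp (θ ^ 2)) hlam
      (F := fun X => Real.exp (θ * ∑ w ∈ W, (childless G v w X - childlessProb G lam v w X)))
      (g := fun X => Real.exp (θ * (childless G v w X - childlessProb G lam v w X)))
      (fun X => (Real.exp_pos _).le) ?_ ?_
    · refine (le_of_eq ?_).trans (step.trans ?_)
      · refine indepSum_congr fun X _ => ?_
        rw [Finset.sum_insert hw, mul_add, add_comm, Real.exp_add]
      · rw [Finset.card_insert_of_notMem hw, pow_succ' (Real.exp (θ ^ 2)), mul_assoc]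
        exact mul_le_mul_of_nonneg_left (ih ((Finset.subset_insert _ _).trans hW))
          (Real.exp_pos _).le
    -- The factors of the other neighbours ignore the children of `w`: their child sets are disjoint
    -- from these (no 4-cycle), and their free children are unaffected (no 5-cycle).
    · intro Y R hR
      congr 2
      refine Finset.sum_congr rfl fun w' hw' => ?_
      have hvw' : G.Adj v w' := by simpa using hW (Finset.mem_insert_of_mem hw')
      have hne : w ≠ w' := by rintro rfl; exact hw hw'
      have hdisj : Disjoint R (children G v w') := by
        rw [Finset.disjoint_left]
        intro x hxR hx
        have hx₁ := mem_children.mp (hR hxR)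
        have hx₂ := mem_children.mp hx
        exact no_quadrangle hg hvw hx₁.2 hx₂.2.symm hvw'.symm hx₁.1.symm hne
      congr 1
      · unfold childless
        simp only [Finset.disjoint_union_left, hdisj, and_true]
      · unfold childlessProb
        rw [freeChildren_union]
        intro x hx u hu hadj
        exact no_pentagon hg hvw (mem_children.mp (hR hu)).2 hadj.symm
          (mem_children.mp hx).2.symm hvw'.symm
    -- Given `Y`, only `R = ∅` leaves `w` childless. It has weight 1 out of `(1 + lam)^|U|`, so the
    -- indicator is Bernoulli with parameter `p`, and `p` is the same for all `R` because there are
    -- no triangles.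
    · intro Y hY
      set U := (children G v w).filter (Free G Y) with hU
      set p := childlessProb G lam v w Y with hp
      have hP : (0 : ℝ) < (1 + lam) ^ U.card := by positivity
      have hpP : p * (1 + lam) ^ U.card = 1 := by
        rw [hp]
        unfold childlessProb
        exact inv_mul_cancel₀ hP.ne'
      have e : ∑ R ∈ U.powerset, lam ^ R.card *
          Real.exp (θ * (childless G v w (Y ∪ R) - childlessProb G lam v w (Y ∪ R))) =
          ∑ R ∈ U.powerset, (lam ^ R.card * Real.exp (θ * (0 - p)) +
            if R = ∅ then Real.exp (θ * (1 - p)) - Real.exp (θ * (0 - p)) else 0) := by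
        refine Finset.sum_congr rfl fun R hR => ?_
        have hRS : R ⊆ children G v w :=
          (Finset.mem_powerset.mp hR).trans (Finset.filter_subset _ _)
        have e1 : childlessProb G lam v w (Y ∪ R) = p := by
          rw [hp]
          unfold childlessProb
          rw [freeChildren_union]
          intro x hx u hu hadj
          exact isIndepSet_children hg v w hx (hRS hu) hadj.ne hadj
        rw [e1]
        unfold childless
        by_cases hR0 : R = ∅
        · subst hR0
          simp [hY]
        · have : ¬ Disjoint (Y ∪ R) (children G v w) := by
            rw [Finset.disjoint_union_left, not_and_or]
            right
            intro hd
            exact hR0 (Finset.disjoint_self_iff_empty _ |>.mp (hd.mono_right hRS))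
          simp [this, hR0]
      rw [e, Finset.sum_add_distrib, ← Finset.sum_mul, sum_powerset_pow, Finset.sum_ite_eq',
        if_pos (Finset.empty_mem_powerset _)]
      have tp := mul_le_mul_of_nonneg_right (two_point_mgf
        (childlessProb_nonneg (G := G) hlam v w Y)
        (childlessProb_le_one hlam v w Y) hθ) hP.le
      rw [← hp] at tp
      refine le_trans (le_of_eq ?_) tp
      linear_combination (Real.exp (θ * (0 - p)) - Real.exp (θ * (1 - p))) * hpP

/-- Given the set outside the neighbourhood, free neighbours are occupied independently with odds
`lam`. Each contributes a factor `(1 + lam e)/(1 + lam) ≤ exp(2 lam)`, and there are at most `Δ ≤ 3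
/ lam` of them when `lam > 0`. -/
lemma occupied_mgf (hg : 6 ≤ G.egirth) {lam : ℝ} {Δ : ℕ} (hlam : 0 ≤ lam) (hΔ : lam * Δ ≤ 3)
    (v : V) (hv : G.degree v = Δ) :
    indepSum G (fun X => lam ^ X.card * Real.exp ((G.neighborFinset v ∩ X).card)) ≤
      Real.exp 6 * partitionFunction G lam := by
  classical
  have hS : G.IsIndepSet (G.neighborFinset v : Set V) := by
    intro x hx y hy _ hadj
    have hx : G.Adj v x := by simpa using hx
    have hy : G.Adj v y := by simpa using hy
    exact no_triangle hg hx hadj hy.symm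
  have step := indepSum_mul_le hS (K := Real.exp 6) hlam (F := fun _ => 1)
    (g := fun X => Real.exp ((G.neighborFinset v ∩ X).card)) (fun _ => zero_le_one)
    (fun _ _ _ => rfl) ?_
  · simpa [partitionFunction_eq] using step
  · intro Y hY
    set U := (G.neighborFinset v).filter (Free G Y) with hU
    have hUc : (U.card : ℝ) ≤ Δ := by
      rw [← hv, ← SimpleGraph.card_neighborFinset_eq_degree]
      exact_mod_cast Finset.card_filter_le _ _
    have e : ∑ R ∈ U.powerset, lam ^ R.card *
        Real.exp ((G.neighborFinset v ∩ (Y ∪ R)).card) =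
        ∑ R ∈ U.powerset, (lam * Real.exp 1) ^ R.card := by
      refine Finset.sum_congr rfl fun R hR => ?_
      have hRS : R ⊆ G.neighborFinset v :=
        (Finset.mem_powerset.mp hR).trans (Finset.filter_subset _ _)
      rw [Finset.inter_union_distrib_left, Finset.disjoint_iff_inter_eq_empty.mp hY.symm,
        Finset.empty_union, Finset.inter_eq_right.mpr hRS, mul_pow, ← Real.exp_nat_mul, mul_one]
    rw [e, sum_powerset_pow]
    have h1 : 1 + lam * Real.exp 1 ≤ Real.exp (2 * lam) * (1 + lam) := by
      have := Real.add_one_le_exp (2 * lam)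
      have := Real.exp_one_lt_d9
      nlinarith
    calc (1 + lam * Real.exp 1) ^ U.card ≤ (Real.exp (2 * lam) * (1 + lam)) ^ U.card :=
          pow_le_pow_left₀ (by positivity) h1 _
      _ = Real.exp (U.card * (2 * lam)) * (1 + lam) ^ U.card := by
          rw [mul_pow, ← Real.exp_nat_mul]
      _ ≤ _ := by
          refine mul_le_mul_of_nonneg_right (Real.exp_le_exp.mpr ?_) (by positivity)
          nlinarith

-- Markov's inequality for the exponential of `f`.
open scoped Classical in
lemma indepSum_tail {lam K a : ℝ} (hlam : 0 ≤ lam) {f : Finset V → ℝ}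
    (h : indepSum G (fun X => lam ^ X.card * Real.exp (f X)) ≤ K * partitionFunction G lam) :
    indepSum G (fun X => lam ^ X.card * if a < f X then 1 else 0) ≤
      Real.exp (-a) * K * partitionFunction G lam := by
  calc _ ≤ indepSum G (fun X => Real.exp (-a) * (lam ^ X.card * Real.exp (f X))) := by
        refine indepSum_mono fun X _ => ?_
        rw [mul_left_comm, ← Real.exp_add]
        refine mul_le_mul_of_nonneg_left ?_ (pow_nonneg hlam _)
        split_ifs with hx
        · exact Real.one_le_exp (by linarith)
        · exact (Real.exp_pos _).le
    _ = Real.exp (-a) * indepSum G (fun X => lam ^ X.card * Real.exp (f X)) := by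
        unfold indepSum
        rw [Finset.mul_sum]
    _ ≤ _ := by
        rw [mul_assoc]
        exact mul_le_mul_of_nonneg_left h (Real.exp_pos _).le

variable (G) in
/-- The local statistics of `X` at the vertex `v` are typical. -/
def TypicalAt (lam η : ℝ) (Δ : ℕ) (X : Finset V) (v : V) : Prop :=
  ∑ w ∈ G.neighborFinset v, (childless G v w X - childlessProb G lam v w X) ≤ η * Δ ∧
  -(η * Δ) ≤ ∑ w ∈ G.neighborFinset v, (childless G v w X - childlessProb G lam v w X) ∧
  ((G.neighborFinset v ∩ X).card : ℝ) ≤ η * Δ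

-- Chernoff bounds with `θ = ±η/2` control the two deviations, with exponent `-η²Δ/2 + η²Δ/4`. The
-- number of occupied neighbours has the stronger tail `exp(6 - ηΔ)`.
open scoped Classical in
lemma indepSum_not_typicalAt (hg : 6 ≤ G.egirth) {lam η : ℝ} {Δ : ℕ} (hlam : 0 ≤ lam)
    (hΔ : lam * Δ ≤ 3) (hη : 0 < η) (hη1 : η ≤ 1) (v : V) (hv : G.degree v = Δ) :
    indepSum G (fun X => lam ^ X.card * if TypicalAt G lam η Δ X v then 0 else 1) ≤
      (2 + Real.exp 6) * Real.exp (-(η ^ 2 / 4 * Δ)) * partitionFunction G lam := by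
  have hZ := (partitionFunction_pos (G := G) hlam).le
  have hcard : (G.neighborFinset v).card = Δ := by
    rw [SimpleGraph.card_neighborFinset_eq_degree, hv]
  set D : Finset V → ℝ := fun X =>
    ∑ w ∈ G.neighborFinset v, (childless G v w X - childlessProb G lam v w X) with hD
  have tail : ∀ θ : ℝ, |θ| = η / 2 → indepSum G (fun X => lam ^ X.card *
      if η ^ 2 / 2 * Δ < θ * D X then 1 else 0) ≤
      Real.exp (-(η ^ 2 / 4 * Δ)) * partitionFunction G lam := by
    intro θ hθ
    have m := childless_mgf hg hlam (by rw [hθ]; linarith : |θ| ≤ 1) v _ (Finset.Subset.refl _)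
    refine (indepSum_tail hlam m).trans (le_of_eq ?_)
    rw [hcard, ← Real.exp_nat_mul, ← Real.exp_add, ← sq_abs θ, hθ]
    congr 2
    ring
  have t1 := tail (η / 2) (abs_of_pos (by linarith))
  have t2 := tail (-(η / 2)) (by rw [abs_neg, abs_of_pos (by linarith)])
  have t3 := indepSum_tail (a := η * Δ) hlam (occupied_mgf hg hlam hΔ v hv)
  have t3' : Real.exp (-(η * Δ)) * Real.exp 6 * partitionFunction G lam ≤
      Real.exp 6 * Real.exp (-(η ^ 2 / 4 * Δ)) * partitionFunction G lam := by
    refine mul_le_mul_of_nonneg_right ?_ hZ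
    rw [mul_comm]
    refine mul_le_mul_of_nonneg_left (Real.exp_le_exp.mpr ?_) (Real.exp_pos _).le
    have : (0 : ℝ) ≤ Δ := Nat.cast_nonneg _
    have : η ^ 2 / 4 ≤ η := by nlinarith
    nlinarith
  have hsum : indepSum G (fun X => lam ^ X.card * if TypicalAt G lam η Δ X v then 0 else 1) ≤
      indepSum G (fun X => lam ^ X.card * if η ^ 2 / 2 * Δ < η / 2 * D X then 1 else 0) +
      indepSum G (fun X => lam ^ X.card * if η ^ 2 / 2 * Δ < -(η / 2) * D X then 1 else 0) +
      indepSum G (fun X => lam ^ X.card *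
        if η * Δ < ((G.neighborFinset v ∩ X).card : ℝ) then 1 else 0) := by
    unfold indepSum
    rw [← Finset.sum_add_distrib, ← Finset.sum_add_distrib]
    refine Finset.sum_le_sum fun X _ => ?_
    rw [← mul_add, ← mul_add]
    refine mul_le_mul_of_nonneg_left ?_ (pow_nonneg hlam _)
    have n1 : (0 : ℝ) ≤ if η ^ 2 / 2 * Δ < η / 2 * D X then 1 else 0 := by split_ifs <;> norm_num
    have n2 : (0 : ℝ) ≤ if η ^ 2 / 2 * Δ < -(η / 2) * D X then 1 else 0 := by
      split_ifs <;> norm_num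
    have n3 : (0 : ℝ) ≤ if η * Δ < ((G.neighborFinset v ∩ X).card : ℝ) then 1 else 0 := by
      split_ifs <;> norm_num
    by_cases ht : TypicalAt G lam η Δ X v
    · rw [if_pos ht]; positivity
    · rw [if_neg ht]
      by_cases h1 : D X ≤ η * Δ
      · by_cases h2 : -(η * Δ) ≤ D X
        · have h3 : η * Δ < ((G.neighborFinset v ∩ X).card : ℝ) := by
            by_contra h3
            exact ht ⟨h1, h2, not_lt.mp h3⟩
          rw [if_pos h3]
          linarith
        · have : η ^ 2 / 2 * Δ < -(η / 2) * D X := by nlinarith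
          rw [if_pos this]
          linarith
      · have : η ^ 2 / 2 * Δ < η / 2 * D X := by nlinarith
        rw [if_pos this]
        linarith
  nlinarith

open scoped Classical in
lemma expect_not_typical (hg : 6 ≤ G.egirth) {lam η : ℝ} {Δ : ℕ} (hlam : 0 ≤ lam)
    (hΔ : lam * Δ ≤ 3) (hη : 0 < η) (hη1 : η ≤ 1) (hreg : G.IsRegularOfDegree Δ) :
    expect (gibbsPMF G lam hlam) (fun X => if ∀ v, TypicalAt G lam η Δ X.1 v then 0 else 1) ≤
      Fintype.card V * ((2 + Real.exp 6) * Real.exp (-(η ^ 2 / 4 * Δ))) := by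
  have hZ := partitionFunction_pos (G := G) hlam
  rw [expect_gibbs, div_le_iff₀ hZ,
    ← indepSum_eq (fun X => lam ^ X.card * if ∀ v, TypicalAt G lam η Δ X v then 0 else 1)]
  calc _ ≤ indepSum G (fun X => ∑ v, lam ^ X.card * if TypicalAt G lam η Δ X v then 0 else 1) := by
        refine indepSum_mono fun X _ => ?_
        rw [← Finset.mul_sum]
        refine mul_le_mul_of_nonneg_left ?_ (pow_nonneg hlam _)
        have hn : ∀ v ∈ Finset.univ, (0 : ℝ) ≤ if TypicalAt G lam η Δ X v then 0 else 1 := by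
          intro v _; split_ifs <;> norm_num
        split_ifs with h
        · exact Finset.sum_nonneg hn
        · push Not at h
          obtain ⟨v, hv⟩ := h
          have := Finset.single_le_sum hn (Finset.mem_univ v)
          rwa [if_neg hv] at this
    _ = ∑ v, indepSum G (fun X => lam ^ X.card * if TypicalAt G lam η Δ X v then 0 else 1) := by
        unfold indepSum
        rw [Finset.sum_comm]
    _ ≤ ∑ _v : V, (2 + Real.exp 6) * Real.exp (-(η ^ 2 / 4 * Δ)) * partitionFunction G lam :=
        Finset.sum_le_sum fun v _ => indepSum_not_typicalAt hg hlam hΔ hη hη1 v (hreg v)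
    _ = _ := by
        rw [Finset.sum_const, Finset.card_univ, nsmul_eq_mul]
        ring

end Concentration

end HardCore

namespace HardCore

/-! ### The two-step map below the threshold `e` -/

section FixedPoint

open Real

/-- The function `x exp(-x)` increases strictly up to `x = 1`. -/
lemma mul_exp_neg_lt {z s : ℝ} (hs0 : 0 < s) (hs : s ≤ 1) (hz : z < s) :
    z * exp (-z) < s * exp (-s) := by
  have h := add_one_lt_exp (sub_ne_zero.mpr hz.ne : z - s ≠ 0)
  have h1 : z < s * exp (z - s) := by nlinarith
  have h2 : s * exp (-s) = s * exp (z - s) * exp (-z) := by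
    rw [mul_assoc, ← exp_add]; congr 2; ring
  rw [h2]
  exact mul_lt_mul_of_pos_right h1 (exp_pos _)

/-- This is the critical case `c = e` of the two-step inequality for `y ≥ 1`. With `y = 1 + u`, the
quantity `2u/(u + 2)` separates the two sides. -/
lemma one_sub_exp_le_log {y : ℝ} (hy : 1 ≤ y) : 1 - exp (1 - y) ≤ log y := by
  obtain ⟨u, rfl⟩ : ∃ u, y = 1 + u := ⟨y - 1, by ring⟩
  have hu : 0 ≤ u := by linarith
  have h1 := Real.le_log_one_add_of_nonneg hu
  have h2 : 1 - 2 * u / (u + 2) ≤ exp (-u) := by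
    rcases lt_or_ge u 2 with h | h
    · have hd : 0 < 2 - u := by linarith
      -- The same logarithm bound at `2u/(2 - u)` reads `u ≤ log((2 + u)/(2 - u))`.
      have h3 := Real.le_log_one_add_of_nonneg (x := 2 * u / (2 - u)) (by positivity)
      have e1 : 2 * (2 * u / (2 - u)) / (2 * u / (2 - u) + 2) = u := by
        field_simp
        ring
      have e2 : 1 + 2 * u / (2 - u) = (u + 2) / (2 - u) := by field_simp; ring
      rw [e1, e2, Real.le_log_iff_exp_le (by positivity)] at h3
      rw [exp_neg]
      have e3 : 1 - 2 * u / (u + 2) = ((u + 2) / (2 - u))⁻¹ := by field_simp; ring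
      rw [e3]
      exact inv_anti₀ (exp_pos _) h3
    · have : 1 ≤ 2 * u / (u + 2) := by rw [le_div_iff₀ (by linarith)]; linarith
      linarith [exp_pos (-u)]
  rw [show 1 - (1 + u) = -u by ring]
  linarith

/-- Below the threshold `e`, the two-fold iteration of `x ↦ c * exp (-x)` stays below the
diagonal on `[1 - ε / 4, ∞)`. -/
lemma two_step_lt {ε c y : ℝ} (h0 : 0 < ε) (h1 : ε < 1) (hc' : c ≤ (1 - ε) * exp 1)
    (hy : 1 - ε / 4 ≤ y) : c * exp (-(c * exp (-y))) < y := by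
  set z := c * exp (-y) with hz
  have hcz : c = z * exp y := by rw [hz, mul_assoc, ← exp_add]; simp
  -- Multiplying by `exp y` turns `c` into `z exp y`, so the claim compares one function at `z` and
  -- at `y`.
  suffices h : z * exp (-z) < y * exp (-y) by
    have := mul_lt_mul_of_pos_right h (exp_pos y)
    rw [mul_assoc y, ← exp_add] at this
    simp only [neg_add_cancel, exp_zero, mul_one] at this
    calc c * exp (-z) = z * exp (-z) * exp y := by rw [hcz]; ring
      _ < y := this
  have hzle : z ≤ (1 - ε) * exp (1 - y) := by
    rw [hz, sub_eq_add_neg 1 y, exp_add, ← mul_assoc]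
    exact mul_le_mul_of_nonneg_right hc' (exp_pos _).le
  rcases lt_or_ge y 1 with hy1 | hy1
  · refine mul_exp_neg_lt (by linarith) hy1.le (hzle.trans_lt ?_)
    have a := add_one_le_exp (y - 1)
    have b : exp (1 - y) * exp (y - 1) = 1 := by rw [← exp_add]; simp
    have p := exp_pos (1 - y)
    -- The choice `ε / 4` leaves room here: `(1 - ε/4)² > 1 - ε`.
    have hsq : 1 - ε < y * y := by nlinarith
    have : (1 - ε) * exp (1 - y) < y * y * exp (1 - y) := mul_lt_mul_of_pos_right hsq p
    have : y * exp (1 - y) ≤ 1 := by nlinarith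
    nlinarith
  · have hs1 : exp (1 - y) ≤ 1 := exp_le_one_iff.mpr (by linarith)
    have hzs : z < exp (1 - y) := by nlinarith [exp_pos (1 - y)]
    refine (mul_exp_neg_lt (exp_pos _) hs1 hzs).trans_le ?_
    have l := one_sub_exp_le_log hy1
    rw [Real.le_log_iff_exp_le (by linarith)] at l
    calc exp (1 - y) * exp (-exp (1 - y)) = exp (1 - exp (1 - y)) * exp (-y) := by
          rw [← exp_add, ← exp_add]; congr 1; ring
      _ ≤ _ := mul_le_mul_of_nonneg_right l (exp_pos _).le

/-- By compactness the strict inequality of `two_step_lt` has a uniform margin; the bound `y ≤ 3`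
serves only to make the domain compact. -/
lemma exists_gap {ε : ℝ} (h0 : 0 < ε) (h1 : ε < 1) :
    ∃ κ > 0, ∀ c y : ℝ, 0 ≤ c → c ≤ (1 - ε) * exp 1 → 1 - ε / 4 ≤ y → y ≤ 3 →
      c * exp (-(c * exp (-y))) + κ ≤ y := by
  have hK : IsCompact (Set.Icc (0 : ℝ) ((1 - ε) * exp 1) ×ˢ Set.Icc (1 - ε / 4) 3) :=
    isCompact_Icc.prod isCompact_Icc
  have hne : (Set.Icc (0 : ℝ) ((1 - ε) * exp 1) ×ˢ Set.Icc (1 - ε / 4) 3).Nonempty :=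
    ⟨(0, 1), ⟨le_rfl, by have := exp_pos 1; nlinarith⟩, ⟨by dsimp; linarith, by norm_num⟩⟩
  obtain ⟨⟨c₀, y₀⟩, hm, hmin⟩ := hK.exists_isMinOn hne
    (f := fun p : ℝ × ℝ => p.2 - p.1 * exp (-(p.1 * exp (-p.2)))) (by fun_prop)
  refine ⟨y₀ - c₀ * exp (-(c₀ * exp (-y₀))), ?_, ?_⟩
  · linarith [two_step_lt h0 h1 hm.1.2 hm.2.1]
  · intro c y a b d e
    have := hmin (show (c, y) ∈ _ from ⟨⟨a, b⟩, ⟨d, e⟩⟩)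
    simp only [Set.mem_ofPred_eq] at this
    linarith

end FixedPoint

/-! ### Local uniformity of typical sets -/

section LocalUniformity

variable {V : Type} [Fintype V] [DecidableEq V] {G : SimpleGraph V} [DecidableRel G.Adj]

lemma sum_childless (X : Finset V) (v : V) :
    ∑ w ∈ G.neighborFinset v, childless G v w X = unblocked G X v := by
  classical
  unfold childless unblocked
  rw [Finset.sum_boole]

/-- A free child has no occupied neighbour at all, hence no occupied neighbour other than `w`. -/
lemma freeChildren_le_unblocked (X : Finset V) (v w : V) :
    freeChildren G v w X ≤ unblocked G X w := by
  classical
  refine Finset.card_le_card fun x hx => ?_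
  simp only [Finset.mem_filter, mem_children, SimpleGraph.mem_neighborFinset] at hx ⊢
  refine ⟨hx.1.2, Finset.disjoint_left.mpr fun u hu hu' => ?_⟩
  exact hx.2 u hu (mem_children.mp hu').2

/-- The extra 1 is for `v`, which is a neighbour of `w` but not a child. Without `w ∉ X` the
children would all be blocked by `w` itself. -/
lemma unblocked_le_freeChildren (X : Finset V) (v : V) {w : V} (hw : w ∉ X) :
    unblocked G X w ≤ freeChildren G v w X + 1 := by
  classical
  unfold unblocked freeChildren
  refine (Finset.card_le_card (t := insert v ((children G v w).filter (Free G X))) ?_).trans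
    (Finset.card_insert_le _ _)
  intro x hx
  simp only [Finset.mem_filter, Finset.mem_insert, mem_children,
    SimpleGraph.mem_neighborFinset] at hx ⊢
  by_cases hxv : x = v
  · exact Or.inl hxv
  · refine Or.inr ⟨⟨hxv, hx.1⟩, fun u hu hadj => ?_⟩
    refine Finset.disjoint_left.mp hx.2 hu (mem_children.mpr ⟨?_, hadj⟩)
    rintro rfl
    exact hw hu

lemma unblocked_le_degree (X : Finset V) (v : V) : unblocked G X v ≤ G.degree v := by
  classical
  unfold unblocked
  rw [← SimpleGraph.card_neighborFinset_eq_degree]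
  exact Finset.card_filter_le _ _

/-- Typical local statistics determine the number of unblocked neighbours. -/
lemma unblocked_le_of_typical [Nonempty V] {ε κ η lam : ℝ} {Δ : ℕ} (hreg : G.IsRegularOfDegree Δ)
    (hgap : ∀ c y : ℝ, 0 ≤ c → c ≤ (1 - ε) * Real.exp 1 → 1 - ε / 4 ≤ y → y ≤ 3 →
      c * Real.exp (-(c * Real.exp (-y))) + κ ≤ y)
    (hη : 0 < η) (hη7 : 7 * η ≤ 1) (hηκ : 48 * η < κ) (hlam : 0 < lam) (hlamη : lam ≤ η)
    (hc : lam * Δ ≤ (1 - ε) * Real.exp 1) (hc3 : lam * Δ ≤ 3) {X : Finset V}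
    (hX : ∀ v, TypicalAt G lam η Δ X v) (v : V) :
    lam * unblocked G X v ≤ 1 - ε / 4 := by
  obtain ⟨vM, hM⟩ := Finite.exists_max (fun v => unblocked G X v)
  obtain ⟨vm, hm⟩ := Finite.exists_min (fun v => unblocked G X v)
  obtain ⟨M, hMdef⟩ : ∃ M : ℝ, M = (unblocked G X vM : ℝ) := ⟨_, rfl⟩
  obtain ⟨m, hmdef⟩ : ∃ m : ℝ, m = (unblocked G X vm : ℝ) := ⟨_, rfl⟩
  have hMr : ∀ w, (unblocked G X w : ℝ) ≤ M := fun w => by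
    rw [hMdef]; exact_mod_cast hM w
  have hmr : ∀ w, m ≤ (unblocked G X w : ℝ) := fun w => by
    rw [hmdef]; exact_mod_cast hm w
  have hm0 : 0 ≤ m := hmdef ▸ Nat.cast_nonneg _
  have hD0 : (0 : ℝ) ≤ Δ := Nat.cast_nonneg _
  have hcard : ∀ v, (G.neighborFinset v).card = Δ := fun v => by
    rw [SimpleGraph.card_neighborFinset_eq_degree, hreg v]
  have hMΔ : M ≤ Δ := by
    rw [hMdef]
    exact_mod_cast (hreg vM) ▸ unblocked_le_degree X vM
  have hmΔ : m ≤ Δ := (hmr vM).trans (hMdef ▸ hMΔ)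
  have hlam1 : lam ≤ 1 := by linarith
  have lower : Δ * Real.exp (-(lam * M)) - η * Δ ≤ m := by
    have h := (hX vm).2.1
    rw [Finset.sum_sub_distrib, sum_childless] at h
    have hs : ∑ _w ∈ G.neighborFinset vm, Real.exp (-(lam * M)) ≤
        ∑ w ∈ G.neighborFinset vm, childlessProb G lam vm w X := by
      refine Finset.sum_le_sum fun w _ => ?_
      unfold childlessProb
      rw [Real.exp_neg]
      refine inv_anti₀ (by positivity) ?_
      have hf : (freeChildren G vm w X : ℝ) ≤ M :=
        le_trans (by exact_mod_cast freeChildren_le_unblocked X vm w) (hMr w)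
      calc (1 + lam) ^ freeChildren G vm w X ≤ Real.exp lam ^ freeChildren G vm w X :=
            pow_le_pow_left₀ (by linarith) (by linarith [Real.add_one_le_exp lam]) _
        _ = Real.exp (freeChildren G vm w X * lam) := by rw [← Real.exp_nat_mul]
        _ ≤ Real.exp (lam * M) := Real.exp_le_exp.mpr (by nlinarith)
    rw [Finset.sum_const, hcard, nsmul_eq_mul] at hs
    linarith
  -- One `ηΔ` is the deviation, the other bounds the occupied neighbours. In `4 lam`, one `lam` pays
  -- for the parent `v` and `3 lam` for replacing `log(1 + lam)` by `lam - lam²`, as `lam * m ≤ 3`.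
  have upper : M ≤ 2 * (η * Δ) + Δ * Real.exp (4 * lam - lam * m) := by
    have h := (hX vM).1
    have hB := (hX vM).2.2
    rw [Finset.sum_sub_distrib, sum_childless] at h
    have hs : ∑ w ∈ G.neighborFinset vM, childlessProb G lam vM w X ≤
        ∑ w ∈ G.neighborFinset vM, ((if w ∈ X then 1 else 0) +
          Real.exp (4 * lam - lam * m)) := by
      refine Finset.sum_le_sum fun w _ => ?_
      split_ifs with hw
      · linarith [childlessProb_le_one (G := G) hlam.le vM w X,
          Real.exp_pos (4 * lam - lam * m)]
      · rw [zero_add]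
        unfold childlessProb
        rw [show 4 * lam - lam * m = -(lam * m - 4 * lam) by ring, Real.exp_neg]
        refine inv_anti₀ (Real.exp_pos _) ?_
        have hf : m ≤ freeChildren G vM w X + 1 :=
          (hmr w).trans (by exact_mod_cast unblocked_le_freeChildren X vM hw)
        have hexp : Real.exp (lam - lam ^ 2) ≤ 1 + lam := by
          rw [← Real.le_log_iff_exp_le (by linarith)]
          refine le_trans ?_ (Real.one_sub_inv_le_log_of_pos (by linarith))
          have hp : 0 < 1 + lam := by linarith
          rw [show 1 - (1 + lam)⁻¹ = lam / (1 + lam) by field_simp; ring, le_div_iff₀ hp]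
          nlinarith [pow_pos hlam 3]
        calc Real.exp (lam * m - 4 * lam)
            ≤ Real.exp (freeChildren G vM w X * (lam - lam ^ 2)) := by
              refine Real.exp_le_exp.mpr ?_
              have a1 : 0 ≤ lam - lam ^ 2 := by nlinarith
              have a2 : (m - 1) * (lam - lam ^ 2) ≤
                  freeChildren G vM w X * (lam - lam ^ 2) :=
                mul_le_mul_of_nonneg_right (by linarith) a1
              have a3 : lam * m ≤ 3 := by nlinarith
              nlinarith
          _ = Real.exp (lam - lam ^ 2) ^ freeChildren G vM w X := by rw [← Real.exp_nat_mul]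
          _ ≤ _ := pow_le_pow_left₀ (Real.exp_pos _).le hexp _
    rw [Finset.sum_add_distrib, Finset.sum_const, hcard, nsmul_eq_mul, Finset.sum_boole,
      Finset.filter_mem_eq_inter] at hs
    linarith
  set c := lam * Δ with hcdef
  have hc0 : 0 ≤ c := by positivity
  set y := lam * M with hydef
  have hy3 : y ≤ 3 := le_trans (mul_le_mul_of_nonneg_left hMΔ hlam.le) hc3
  have hlm : c * Real.exp (-y) - c * η ≤ lam * m := by
    have := mul_le_mul_of_nonneg_left lower hlam.le
    rw [hcdef]
    linarith
  have hy : y ≤ 2 * η * c + c * Real.exp (4 * lam - lam * m) := by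
    have := mul_le_mul_of_nonneg_left upper hlam.le
    rw [hcdef, hydef]
    linarith
  -- `7η` is `4 lam ≤ 4η` plus `cη ≤ 3η`.
  have hexp : Real.exp (4 * lam - lam * m) ≤
      Real.exp (-(c * Real.exp (-y))) * (1 + 14 * η) := by
    have h1 : Real.exp (7 * η) ≤ 1 + 14 * η := by
      have := (abs_le.mp (Real.abs_exp_sub_one_sub_id_le
        (by rw [abs_of_nonneg (by linarith)]; exact hη7 : |7 * η| ≤ 1))).2
      nlinarith
    calc Real.exp (4 * lam - lam * m) ≤ Real.exp (-(c * Real.exp (-y)) + 7 * η) := by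
          refine Real.exp_le_exp.mpr ?_
          nlinarith
      _ = Real.exp (-(c * Real.exp (-y))) * Real.exp (7 * η) := Real.exp_add _ _
      _ ≤ _ := mul_le_mul_of_nonneg_left h1 (Real.exp_pos _).le
  have he1 : c * Real.exp (-(c * Real.exp (-y))) ≤ 3 := by
    have : Real.exp (-(c * Real.exp (-y))) ≤ 1 :=
      Real.exp_le_one_iff.mpr (neg_nonpos.mpr (mul_nonneg hc0 (Real.exp_pos _).le))
    nlinarith
  -- `48η` is `2ηc ≤ 6η` plus `14η` times a quantity that is at most 3.
  have hy' : y ≤ c * Real.exp (-(c * Real.exp (-y))) + 48 * η := by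
    have := mul_le_mul_of_nonneg_left hexp hc0
    nlinarith
  have hfin : y ≤ 1 - ε / 4 := by
    by_contra hcon
    have := hgap c y hc0 hc (by linarith) hy3
    linarith
  exact le_trans (mul_le_mul_of_nonneg_left (hMr v) hlam.le) hfin

end LocalUniformity

end HardCore

namespace HardCore

/-! ### The identical coupling and its contraction -/

section Coupling

variable {V : Type} [Fintype V] [DecidableEq V] {G : SimpleGraph V}

/-- The number of vertices on which two independent sets differ. -/
def hamming (p : IndepSets G × IndepSets G) : ℝ := ((symmDiff p.1.1 p.2.1).card : ℝ)

lemma hamming_nonneg (p : IndepSets G × IndepSets G) : 0 ≤ hamming p := Nat.cast_nonneg _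

lemma hamming_le (p : IndepSets G × IndepSets G) : hamming p ≤ Fintype.card V := by
  unfold hamming
  exact_mod_cast Finset.card_le_univ _

lemma one_le_hamming {p : IndepSets G × IndepSets G} (h : p.1 ≠ p.2) : 1 ≤ hamming p := by
  unfold hamming
  have : 0 < (symmDiff p.1.1 p.2.1).card := by
    rw [Finset.card_pos, Finset.nonempty_iff_ne_empty]
    intro he
    exact h (Subtype.ext (symmDiff_eq_bot.mp he))
  exact_mod_cast this

variable [Nonempty V]

variable (G) in
/-- The identical coupling: both chains choose the same vertex and the same coin. -/
noncomputable def couple (lam : ℝ) (p : IndepSets G × IndepSets G) :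
    PMF (IndepSets G × IndepSets G) :=
  (PMF.uniformOfFintype V).bind fun v =>
    (coin (lam / (1 + lam))).map fun b => (update G p.1 v b, update G p.2 v b)

lemma expect_couple_fst (lam : ℝ) (p : IndepSets G × IndepSets G) (f : IndepSets G → ℝ) :
    expect (couple G lam p) (fun q => f q.1) = expect (glauberStep G lam p.1) f := by
  simp only [couple, glauberStep, expect_bind, expect_map]

lemma expect_couple_snd (lam : ℝ) (p : IndepSets G × IndepSets G) (f : IndepSets G → ℝ) :
    expect (couple G lam p) (fun q => f q.2) = expect (glauberStep G lam p.2) f := by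
  simp only [couple, glauberStep, expect_bind, expect_map]

lemma expect_couple {lam : ℝ} (h : 0 ≤ lam) (p : IndepSets G × IndepSets G)
    (f : IndepSets G × IndepSets G → ℝ) :
    expect (couple G lam p) f = (1 / (Fintype.card V : ℝ)) * ∑ v,
      (lam / (1 + lam) * f (update G p.1 v true, update G p.2 v true) +
        1 / (1 + lam) * f (update G p.1 v false, update G p.2 v false)) := by
  unfold couple
  rw [expect_bind, expect_uniform]
  congr 1
  refine Finset.sum_congr rfl fun v _ => ?_
  have h1 : 0 < 1 + lam := by linarith
  rw [expect_map, expect_coin (by positivity) ((div_le_one h1).mpr (by linarith))]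
  congr 2
  field_simp
  ring

-- Away from `v` nothing changes. At `v` the copies agree afterwards unless an insertion is tried
-- and exactly one copy admits it.
open scoped Classical in
lemma hamming_update_le (X Z : IndepSets G) (v : V) (b : Bool) :
    hamming (update G X v b, update G Z v b) ≤ hamming (X, Z) -
      (if v ∈ symmDiff X.1 Z.1 then 1 else 0) +
      if b = true ∧ ¬ (Free G X.1 v ↔ Free G Z.1 v) then 1 else 0 := by
  unfold hamming
  dsimp only
  have hsub : symmDiff (update G X v b).1 (update G Z v b).1 ⊆ (symmDiff X.1 Z.1).erase v ∪
      (if b = true ∧ ¬ (Free G X.1 v ↔ Free G Z.1 v) then {v} else ∅) := by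
    intro u hu
    have hX := mem_update G X v u b
    have hZ := mem_update G Z v u b
    rw [Finset.mem_symmDiff, hX, hZ] at hu
    by_cases huv : u = v
    · rw [if_pos huv, if_pos huv] at hu
      have hb : b = true ∧ ¬ (Free G X.1 v ↔ Free G Z.1 v) := by
        rcases hu with ⟨⟨hb, h1⟩, h2⟩ | ⟨⟨hb, h1⟩, h2⟩
        · exact ⟨hb, fun hiff => h2 ⟨hb, hiff.mp h1⟩⟩
        · exact ⟨hb, fun hiff => h2 ⟨hb, hiff.mpr h1⟩⟩
      rw [if_pos hb]
      simp [huv]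
    · rw [if_neg huv, if_neg huv] at hu
      refine Finset.mem_union_left _ (Finset.mem_erase.mpr ⟨huv, Finset.mem_symmDiff.mpr hu⟩)
  have hc := (Finset.card_le_card hsub).trans (Finset.card_union_le _ _)
  have h1 : (((symmDiff X.1 Z.1).erase v).card : ℝ) = ((symmDiff X.1 Z.1).card : ℝ) -
      (if v ∈ symmDiff X.1 Z.1 then 1 else 0) := by
    split_ifs with hv
    · rw [Finset.card_erase_of_mem hv, Nat.cast_sub (Finset.card_pos.mpr ⟨v, hv⟩)]
      simp
    · rw [Finset.erase_eq_of_notMem hv, sub_zero]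
  rw [← h1]
  refine le_trans (Nat.cast_le.mpr hc) ?_
  push_cast
  split_ifs <;> simp

variable [DecidableRel G.Adj]

-- If `w` is free in `A` but not in `B`, it has a neighbour `v ∈ B \ A`, and freeness in `A` makes
-- `w` an unblocked neighbour of `v` in `A`. Each disagreement is thus charged in the copy that does
-- not contain it.
open scoped Classical in
lemma card_mismatch_le {X Z : IndepSets G} {K : ℝ}
    (hX : ∀ v, (unblocked G X.1 v : ℝ) ≤ K) (hZ : ∀ v, (unblocked G Z.1 v : ℝ) ≤ K) :
    ((Finset.univ.filter fun v => ¬ (Free G X.1 v ↔ Free G Z.1 v)).card : ℝ) ≤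
      hamming (X, Z) * K := by
  set N : Finset V → V → Finset V := fun Y v =>
    (G.neighborFinset v).filter fun w => Disjoint Y (children G v w) with hN
  have hsub : (Finset.univ.filter fun v => ¬ (Free G X.1 v ↔ Free G Z.1 v)) ⊆
      (symmDiff X.1 Z.1).biUnion fun v => if v ∈ Z.1 then N X.1 v else N Z.1 v := by
    have key : ∀ A B : IndepSets G, ∀ w, Free G A.1 w → ¬ Free G B.1 w →
        ∃ v ∈ B.1, v ∉ A.1 ∧ w ∈ N A.1 v := by
      intro A B w hA hB
      unfold Free at hB
      push Not at hB
      obtain ⟨v, hvB, hadj⟩ := hB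
      refine ⟨v, hvB, fun hvA => hA v hvA hadj, ?_⟩
      simp only [hN, Finset.mem_filter, SimpleGraph.mem_neighborFinset]
      refine ⟨hadj.symm, Finset.disjoint_left.mpr fun u hu hu' => ?_⟩
      exact hA u hu (mem_children.mp hu').2
    intro w hw
    simp only [Finset.mem_filter, Finset.mem_univ, true_and] at hw
    rw [Finset.mem_biUnion]
    by_cases hfX : Free G X.1 w
    · have hfZ : ¬ Free G Z.1 w := by tauto
      obtain ⟨v, h1, h2, h3⟩ := key X Z w hfX hfZ
      exact ⟨v, Finset.mem_symmDiff.mpr (Or.inr ⟨h1, h2⟩), by rw [if_pos h1]; exact h3⟩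
    · have hfZ : Free G Z.1 w := by tauto
      obtain ⟨v, h1, h2, h3⟩ := key Z X w hfZ hfX
      exact ⟨v, Finset.mem_symmDiff.mpr (Or.inl ⟨h1, h2⟩), by rw [if_neg h2]; exact h3⟩
  refine le_trans (Nat.cast_le.mpr ((Finset.card_le_card hsub).trans Finset.card_biUnion_le)) ?_
  rw [Nat.cast_sum]
  unfold hamming
  rw [← nsmul_eq_mul]
  refine Finset.sum_le_card_nsmul _ _ _ fun v _ => ?_
  split_ifs
  · exact hX v
  · exact hZ v

/-- The identical coupling contracts if both sets have few unblocked neighbours everywhere. -/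
lemma expect_couple_hamming_le {lam ε : ℝ} (h : 0 < lam) {X Z : IndepSets G}
    (hX : ∀ v, lam * unblocked G X.1 v ≤ 1 - ε / 4)
    (hZ : ∀ v, lam * unblocked G Z.1 v ≤ 1 - ε / 4) :
    expect (couple G lam (X, Z)) hamming ≤
      (1 - ε / (4 * Fintype.card V)) * hamming (X, Z) := by
  classical
  have hn : (0 : ℝ) < Fintype.card V := by exact_mod_cast Fintype.card_pos
  have h1 : 0 < 1 + lam := by linarith
  rw [expect_couple h.le]
  have hmis := card_mismatch_le (K := (1 - ε / 4) / lam)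
    (fun v => by rw [le_div_iff₀ h, mul_comm]; exact hX v)
    (fun v => by rw [le_div_iff₀ h, mul_comm]; exact hZ v)
  have hsum : ∑ v, (lam / (1 + lam) * hamming (update G X v true, update G Z v true) +
        1 / (1 + lam) * hamming (update G X v false, update G Z v false)) ≤
      ∑ v, (hamming (X, Z) - (if v ∈ symmDiff X.1 Z.1 then 1 else 0) +
        lam / (1 + lam) * if ¬ (Free G X.1 v ↔ Free G Z.1 v) then 1 else 0) := by
    refine Finset.sum_le_sum fun v _ => ?_
    have t := hamming_update_le X Z v true
    have f := hamming_update_le X Z v false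
    simp only [true_and, Bool.false_eq_true, false_and, if_false, add_zero] at t f
    have t' := mul_le_mul_of_nonneg_left t (div_nonneg h.le h1.le)
    have f' := mul_le_mul_of_nonneg_left f (div_nonneg zero_le_one h1.le)
    refine (add_le_add t' f').trans (le_of_eq ?_)
    field_simp
    ring
  have hrhs : ∑ v, (hamming (X, Z) - (if v ∈ symmDiff X.1 Z.1 then 1 else 0) +
        lam / (1 + lam) * if ¬ (Free G X.1 v ↔ Free G Z.1 v) then 1 else 0) =
      Fintype.card V * hamming (X, Z) - ((symmDiff X.1 Z.1).card : ℝ) + lam / (1 + lam) *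
        ((Finset.univ.filter fun v => ¬ (Free G X.1 v ↔ Free G Z.1 v)).card : ℝ) := by
    rw [Finset.sum_add_distrib, Finset.sum_sub_distrib, Finset.sum_const, Finset.card_univ,
      nsmul_eq_mul, Finset.sum_boole, ← Finset.mul_sum, Finset.sum_boole,
      Finset.filter_mem_eq_inter, Finset.univ_inter]
  rw [hrhs] at hsum
  -- A uniform vertex heals `H/n` disagreements on average and creates at most `(1 - ε/4) H/n`,
  -- where `H` is the current distance.
  have hp : lam / (1 + lam) ≤ lam := div_le_self h.le (by linarith)
  have hlast : lam / (1 + lam) *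
      ((Finset.univ.filter fun v => ¬ (Free G X.1 v ↔ Free G Z.1 v)).card : ℝ) ≤
      hamming (X, Z) * (1 - ε / 4) := by
    calc _ ≤ lam * (hamming (X, Z) * ((1 - ε / 4) / lam)) :=
          mul_le_mul hp hmis (Nat.cast_nonneg _) h.le
      _ = _ := by field_simp
  have hH : ((symmDiff X.1 Z.1).card : ℝ) = hamming (X, Z) := rfl
  rw [hH] at hsum
  calc _ ≤ 1 / (Fintype.card V : ℝ) * (Fintype.card V * hamming (X, Z) - hamming (X, Z) +
        hamming (X, Z) * (1 - ε / 4)) :=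
        mul_le_mul_of_nonneg_left (by linarith) (by positivity)
    _ = _ := by field_simp; ring

end Coupling

/-! ### Mixing from a warm start and annealing -/

section Mixing

variable {V : Type} [Fintype V] [DecidableEq V] [Nonempty V] {G : SimpleGraph V}

/-- The definition splits off the first step, whereas inductions along the coupling need the last
one. -/
lemma glauber_succ (lam : ℝ) (T : ℕ) (X : IndepSets G) :
    glauber G lam (T + 1) X = (glauber G lam T X).bind (glauberStep G lam) := by
  induction T generalizing X with
  | zero => simp [glauber]
  | succ T ih =>
    rw [glauber, glauber, PMF.bind_bind]
    congr 1
    funext Y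
    exact ih Y

lemma expect_gibbs_glauber {lam : ℝ} (h : 0 ≤ lam) (T : ℕ) (f : IndepSets G → ℝ) :
    expect (gibbsPMF G lam h) (fun X => expect (glauber G lam T X) f) =
      expect (gibbsPMF G lam h) f := by
  induction T generalizing f with
  | zero => simp [glauber, expect_pure]
  | succ T ih =>
    simp_rw [glauber_succ, expect_bind]
    rw [ih, expect_gibbs_glauberStep]

variable (G) in
/-- `t` steps of the identical coupling, started at independent samples of `μ` and `ν`. -/
noncomputable def coupled (lam : ℝ) (μ ν : PMF (IndepSets G)) :
    ℕ → PMF (IndepSets G × IndepSets G)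
  | 0 => μ.bind fun x => ν.map fun z => (x, z)
  | t + 1 => (coupled lam μ ν t).bind (couple G lam)

lemma expect_coupled_fst (lam : ℝ) (μ ν : PMF (IndepSets G)) (t : ℕ) (f : IndepSets G → ℝ) :
    expect (coupled G lam μ ν t) (fun p => f p.1) =
      expect μ fun X => expect (glauber G lam t X) f := by
  induction t generalizing f with
  | zero => simp [coupled, glauber, expect_bind, expect_map, expect_pure, expect_const]
  | succ t ih =>
    simp_rw [coupled, glauber_succ, expect_bind, expect_couple_fst]
    exact ih fun X => expect (glauberStep G lam X) f

lemma expect_coupled_snd (lam : ℝ) (μ ν : PMF (IndepSets G)) (t : ℕ) (f : IndepSets G → ℝ) :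
    expect (coupled G lam μ ν t) (fun p => f p.2) =
      expect ν fun X => expect (glauber G lam t X) f := by
  induction t generalizing f with
  | zero => simp [coupled, glauber, expect_bind, expect_map, expect_pure, expect_const]
  | succ t ih =>
    simp_rw [coupled, glauber_succ, expect_bind, expect_couple_snd]
    exact ih fun X => expect (glauberStep G lam X) f

/-- Mixing from a warm start, if the coupling contracts outside a set that is unlikely under the
stationary distribution. -/
lemma testClose_glauber {lam ε β : ℝ} (h : 0 < lam) (hε : 0 < ε) (hε1 : ε < 1)
    (μ : PMF (IndepSets G))
    (hwarm : ∀ f : IndepSets G → ℝ, (∀ X, 0 ≤ f X) →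
      expect μ f ≤ 3 * expect (gibbsPMF G lam h.le) f)
    (bad : IndepSets G → ℝ) (hbad₀ : ∀ X, 0 ≤ bad X)
    (hbad : ∀ X Z : IndepSets G, 1 ≤ bad X + bad Z ∨ expect (couple G lam (X, Z)) hamming ≤
      (1 - ε / (4 * Fintype.card V)) * hamming (X, Z))
    (hβ : expect (gibbsPMF G lam h.le) bad ≤ β) (T : ℕ) :
    TestClose (μ.bind (glauber G lam T)) (gibbsPMF G lam h.le)
      (Fintype.card V * (1 - ε / (4 * Fintype.card V)) ^ T +
        16 * (Fintype.card V : ℝ) ^ 2 * β / ε) := by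
  set n : ℝ := (Fintype.card V : ℝ) with hn
  set r := 1 - ε / (4 * n) with hr
  have hn1 : 1 ≤ n := by rw [hn]; exact_mod_cast Fintype.card_pos
  have hr0 : 0 ≤ r := by
    rw [hr, sub_nonneg, div_le_one (by linarith)]
    linarith
  set J := coupled G lam μ (gibbsPMF G lam h.le) with hJ
  have hstep : ∀ p : IndepSets G × IndepSets G, expect (couple G lam p) hamming ≤
      r * hamming p + n * (bad p.1 + bad p.2) := by
    rintro ⟨X, Z⟩
    have h0 := mul_nonneg hr0 (hamming_nonneg (X, Z))
    rcases hbad X Z with hb | hc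
    · have : expect (couple G lam (X, Z)) hamming ≤ n := by
        rw [← expect_const (couple G lam (X, Z)) n]
        exact expect_mono _ hamming_le
      have : n * 1 ≤ n * (bad X + bad Z) := mul_le_mul_of_nonneg_left hb (by linarith)
      dsimp only
      linarith
    · have : 0 ≤ n * (bad X + bad Z) :=
        mul_nonneg (by linarith) (add_nonneg (hbad₀ X) (hbad₀ Z))
      dsimp only
      linarith
  have hrec : ∀ t, expect (J t) hamming ≤ n * r ^ t + 16 * n ^ 2 * β / ε := by
    have hβ0 : 0 ≤ β := (expect_nonneg _ hbad₀).trans hβ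
    intro t
    induction t with
    | zero =>
      have : expect (J 0) hamming ≤ n := by
        rw [← expect_const (J 0) n]
        exact expect_mono _ hamming_le
      have : 0 ≤ 16 * n ^ 2 * β / ε := by positivity
      simp only [pow_zero, mul_one]
      linarith
    | succ t ih =>
      have e : expect (J (t + 1)) hamming ≤ r * expect (J t) hamming + n * (4 * β) := by
        rw [hJ, coupled, expect_bind, ← hJ]
        refine (expect_mono _ hstep).trans ?_
        rw [expect_add, expect_mul_left, expect_mul_left, expect_add,
          hJ, expect_coupled_fst, expect_coupled_snd, expect_gibbs_glauber]
        -- Applying the warm start to the evolved function shows that domination by three times the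
        -- Gibbs law persists. The first copy contributes `3β` and the stationary one `β`.
        have hw := hwarm (fun X => expect (glauber G lam t X) bad)
          (fun X => expect_nonneg _ hbad₀)
        rw [expect_gibbs_glauber] at hw
        have : n * (expect μ (fun X => expect (glauber G lam t X) bad) +
            expect (gibbsPMF G lam h.le) bad) ≤ n * (4 * β) :=
          mul_le_mul_of_nonneg_left (by linarith) (by linarith)
        linarith
      -- Fixed point of the recursion `x ↦ r x + 4nβ`, with `1 - r = ε / (4n)`.
      have hfix : r * (16 * n ^ 2 * β / ε) + n * (4 * β) = 16 * n ^ 2 * β / ε := by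
        rw [hr]
        field_simp
        ring
      have := mul_le_mul_of_nonneg_left ih hr0
      rw [pow_succ]
      linarith
  intro f h0 h1
  have hc : expect (μ.bind (glauber G lam T)) f - expect (gibbsPMF G lam h.le) f =
      expect (J T) (fun p => f p.1 - f p.2) := by
    rw [expect_sub, hJ, expect_coupled_fst, expect_coupled_snd, expect_gibbs_glauber, expect_bind]
  rw [hc]
  -- Coupling inequality: `f p.1 - f p.2` vanishes on the diagonal and is at most one elsewhere.
  refine (expect_mono _ fun p => ?_).trans (hrec T)
  by_cases hp : p.1 = p.2
  · rw [hp, sub_self]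
    exact hamming_nonneg p
  · linarith [one_le_hamming hp, h0 p.2, h1 p.1]

/-- As `0 ^ 0 = 1`, only the empty set has weight at fugacity zero, so annealing starts without
error. -/
lemma expect_gibbs_zero (f : IndepSets G → ℝ) :
    expect (gibbsPMF G 0 le_rfl) f = f (emptySet G) := by
  have key : ∀ g : IndepSets G → ℝ, ∑ X : IndepSets G, (0 : ℝ) ^ X.1.card * g X =
      g (emptySet G) := by
    intro g
    rw [Finset.sum_eq_single (emptySet G)]
    · simp [emptySet]
    · intro X _ hX
      have : X.1.card ≠ 0 := by
        intro h0
        exact hX (Subtype.ext (Finset.card_eq_zero.mp h0))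
      simp [this]
    · simp
  have hZ : partitionFunction G 0 = 1 := by
    have := key fun _ => 1
    simpa [partitionFunction] using this
  rw [expect_gibbs, key, hZ, div_one]

/-- Simulated annealing along equidistant fugacities. -/
lemma testClose_annealing [DecidableRel G.Adj] (hg : 6 ≤ G.egirth) {ε κ η lam : ℝ} {Δ : ℕ}
    (hreg : G.IsRegularOfDegree Δ) (hε : 0 < ε) (hε1 : ε < 1)
    (hgap : ∀ c y : ℝ, 0 ≤ c → c ≤ (1 - ε) * Real.exp 1 → 1 - ε / 4 ≤ y → y ≤ 3 →
      c * Real.exp (-(c * Real.exp (-y))) + κ ≤ y)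
    (hη : 0 < η) (hη7 : 7 * η ≤ 1) (hηκ : 48 * η < κ) (hlam : 0 < lam) (hlamη : lam ≤ η)
    (hc : lam * Δ ≤ (1 - ε) * Real.exp 1) (T k : ℕ) (hk : lam * Fintype.card V ≤ k)
    (hk0 : 0 < k) (i : ℕ) (hi : i ≤ k) :
    TestClose (annealing G (fun j => (j : ℝ) * lam / (k : ℝ)) (fun _ => T) i)
      (gibbsPMF G ((i : ℝ) * lam / (k : ℝ)) (by positivity))
      (i * (Fintype.card V * (1 - ε / (4 * Fintype.card V)) ^ T +
        16 * (Fintype.card V : ℝ) ^ 2 *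
          (Fintype.card V * ((2 + Real.exp 6) * Real.exp (-(η ^ 2 / 4 * Δ)))) / ε)) := by
  classical
  have hk0' : (0 : ℝ) < k := by exact_mod_cast hk0
  have hc3 : lam * Δ ≤ 3 := by
    have := Real.exp_one_lt_d9
    have := Real.exp_pos 1
    nlinarith
  induction i with
  | zero =>
    intro f h0 h1
    have e : (((0 : ℕ) : ℝ) * lam / (k : ℝ)) = 0 := by simp
    have : ∀ (x : ℝ) (hx : 0 ≤ x), x = 0 → expect (gibbsPMF G x hx) f = f (emptySet G) := by
      rintro x hx rfl
      exact expect_gibbs_zero f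
    rw [this _ _ e, annealing, expect_pure]
    simp
  | succ i ih =>
    have ih := ih (by omega)
    set lam' := ((i + 1 : ℕ) : ℝ) * lam / (k : ℝ) with hlam'
    have hpos : 0 < lam' := by rw [hlam']; positivity
    have hle : lam' ≤ lam := by
      rw [hlam', div_le_iff₀ hk0', mul_comm lam]
      exact mul_le_mul_of_nonneg_right (by exact_mod_cast hi) hlam.le
    have hlΔ : lam' * Δ ≤ lam * Δ := mul_le_mul_of_nonneg_right hle (Nat.cast_nonneg _)
    have hdiff : lam' - (i : ℝ) * lam / (k : ℝ) = lam / k := by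
      rw [hlam']; push_cast; ring
    have step := testClose_glauber hpos hε hε1
      (gibbsPMF G ((i : ℝ) * lam / (k : ℝ)) (by positivity))
      (fun f hf => expect_gibbs_le (by positivity)
        (by have : 0 < lam / k := by positivity
            linarith)
        (by rw [hdiff, div_mul_eq_mul_div, div_le_one hk0']; exact hk) hf)
      (fun X => if ∀ v, TypicalAt G lam' η Δ X.1 v then 0 else 1)
      (fun X => by split_ifs <;> norm_num)
      (fun X Z => by
        have typ : ∀ Y : IndepSets G, (∀ v, TypicalAt G lam' η Δ Y.1 v) →
            ∀ v, lam' * unblocked G Y.1 v ≤ 1 - ε / 4 := fun Y hY v =>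
          unblocked_le_of_typical hreg hgap hη hη7 hηκ hpos (hle.trans hlamη) (hlΔ.trans hc)
            (hlΔ.trans hc3) hY v
        by_cases hX : ∀ v, TypicalAt G lam' η Δ X.1 v
        · by_cases hZ : ∀ v, TypicalAt G lam' η Δ Z.1 v
          · exact Or.inr (expect_couple_hamming_le hpos (typ X hX) (typ Z hZ))
          · left
            rw [if_pos hX, if_neg hZ]
            norm_num
        · left
          rw [if_neg hX]
          split_ifs <;> norm_num)
      (expect_not_typical hg hpos.le (hlΔ.trans hc3) hη (by linarith) hreg) T
    -- The earlier error does not grow under the new kernel, and the new stage adds its own.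
    have total := (ih.bind (glauber G lam' T)).trans step
    rw [annealing]
    refine cast ?_ total
    congr 1
    push_cast
    ring

end Mixing

end HardCore

namespace RealRAM

/-! ### Reasoning about programs -/

section Machine

variable {E : ℕ → ℕ → Prop} {α β γ : Type}

lemma run_succ (t : ℕ) (c : Config) : run E (t + 1) c = (step E c).bind (run E t) := rfl

lemma run_seq (t : ℕ) (p q : Prog) (K : List Prog) (s : Store) :
    run E (t + 1) (.seq p q :: K, s) = run E t (p :: q :: K, s) := by
  simp [run_succ, step]

lemma run_loop_of_holds (t : ℕ) (b : Test) (p : Prog) (K : List Prog) (s : Store)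
    (h : b.holds s) : run E (t + 1) (.loop b p :: K, s) = run E t (p :: .loop b p :: K, s) := by
  simp [run_succ, step, h]

lemma run_loop_of_not_holds (t : ℕ) (b : Test) (p : Prog) (K : List Prog) (s : Store)
    (h : ¬ b.holds s) : run E (t + 1) (.loop b p :: K, s) = run E t (K, s) := by
  simp [run_succ, step, h]

lemma run_instr (t : ℕ) (i : Instr) (K : List Prog) (s : Store) :
    run E (t + 1) (.instr i :: K, s) = (i.exec E s).bind fun s' => run E t (K, s') := by
  simp [run_succ, step, PMF.bind_map, Function.comp_def]

/-- Instructions that involve no randomness. -/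
def Instr.IsDet : Instr → Prop
  | .flip _ _ => False
  | .unif _ _ => False
  | _ => True

open scoped Classical in
/-- Effect of an instruction that involves no randomness. -/
noncomputable def Instr.det (E : ℕ → ℕ → Prop) (s : Store) : Instr → Store
  | .const r c => s.setNat r c
  | .add r a b => s.setNat r (s.nat a + s.nat b)
  | .sub r a b => s.setNat r (s.nat a - s.nat b)
  | .load r a => s.setNat r (s.mem (s.nat a))
  | .store a r => s.setMem (s.nat a) (s.nat r)
  | .ofNat r a => s.setReal r (s.nat a)
  | .radd r a b => s.setReal r (s.real a + s.real b)
  | .rsub r a b => s.setReal r (s.real a - s.real b)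
  | .rmul r a b => s.setReal r (s.real a * s.real b)
  | .rdiv r a b => s.setReal r (s.real a / s.real b)
  | .edge r u v => s.setNat r (if E (s.nat u) (s.nat v) then 1 else 0)
  | .flip _ _ => s
  | .unif _ _ => s

lemma Instr.exec_of_isDet (s : Store) {i : Instr} (h : i.IsDet) :
    i.exec E s = PMF.pure (i.det E s) := by
  cases i <;> first | rfl | exact h.elim

/-- Straight-line program. -/
def block : List Instr → Prog
  | [] => .skip
  | i :: l => .seq (.instr i) (block l)

lemma run_block (l : List Instr) (hl : ∀ i ∈ l, i.IsDet) (t : ℕ) (K : List Prog) (s : Store) :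
    run E (2 * l.length + 1 + t) (block l :: K, s) = run E t (K, l.foldl (Instr.det E) s) := by
  induction l generalizing s with
  | nil =>
    rw [show 2 * ([] : List Instr).length + 1 + t = t + 1 by simp; omega]
    simp [run_succ, block, step]
  | cons i l ih =>
    rw [show 2 * (i :: l).length + 1 + t = (2 * l.length + 1 + t) + 1 + 1 by simp; omega, block,
      run_seq, run_instr, Instr.exec_of_isDet s (hl i (by simp)), PMF.pure_bind,
      ih (fun j hj => hl j (by simp [hj]))]
    rfl

/-- Started at `s`, the program `P` terminates after exactly `t` steps, and its effect is a random
`a` with law `ρ` together with a store that is related to `a` by `R`. -/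
def Simulates (E : ℕ → ℕ → Prop) (out : Config → γ) (P : Prog) (s : Store) (t : ℕ) (ρ : PMF α)
    (R : α → Store → Prop) : Prop :=
  ∀ (K : List Prog) (t' : ℕ) (Ψ : α → PMF γ),
    (∀ a s', R a s' → (run E t' (K, s')).map out = Ψ a) →
      (run E (t + t') (P :: K, s)).map out = ρ.bind Ψ

variable {out : Config → γ} {s : Store} {P Q : Prog} {t t' : ℕ} {R : α → Store → Prop}
  {R' : β → Store → Prop}

lemma Simulates.of_eq {ρ : PMF α} (h : Simulates E out P s t ρ R) (ht : t' = t) :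
    Simulates E out P s t' ρ R := ht ▸ h

lemma simulates_block (l : List Instr) (hl : ∀ i ∈ l, i.IsDet) (a : α)
    (h : R a (l.foldl (Instr.det E) s)) :
    Simulates E out (block l) s (2 * l.length + 1) (PMF.pure a) R := by
  intro K t' Ψ hΨ
  rw [run_block l hl, PMF.pure_bind, hΨ a _ h]

/-- The time `t'` may not depend on the random outcome `a`; this keeps the running time
deterministic. -/
lemma Simulates.seq {ρ : PMF α} {ρ' : α → PMF β} (hP : Simulates E out P s t ρ R)
    (hQ : ∀ a s', R a s' → Simulates E out Q s' t' (ρ' a) R') :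
    Simulates E out (.seq P Q) s (1 + t + t') (ρ.bind ρ') R' := by
  intro K t₀ Ψ hΨ
  rw [show 1 + t + t' + t₀ = (t + (t' + t₀)) + 1 by omega, run_seq, PMF.bind_bind]
  exact hP _ _ _ fun a s' h => hQ a s' h K t₀ Ψ hΨ

lemma simulates_loop_of_not_holds {b : Test} (hb : ¬ b.holds s) (a : α) (h : R a s) :
    Simulates E out (.loop b P) s 1 (PMF.pure a) R := by
  intro K t₀ Ψ hΨ
  rw [Nat.add_comm, run_loop_of_not_holds _ _ _ _ _ hb, PMF.pure_bind, hΨ a s h]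

lemma simulates_loop_of_holds {b : Test} (hb : b.holds s) {ρ : PMF α} {ρ' : α → PMF β}
    (hP : Simulates E out P s t ρ R)
    (hQ : ∀ a s', R a s' → Simulates E out (.loop b P) s' t' (ρ' a) R') :
    Simulates E out (.loop b P) s (1 + t + t') (ρ.bind ρ') R' := by
  intro K t₀ Ψ hΨ
  rw [show 1 + t + t' + t₀ = (t + (t' + t₀)) + 1 by omega, run_loop_of_holds _ _ _ _ _ hb,
    PMF.bind_bind]
  exact hP _ _ _ fun a s' h => hQ a s' h K t₀ Ψ hΨ

lemma simulates_unif {n : ℕ} [NeZero n] (r m : ℕ) (hm : s.nat m = n) {R : Fin n → Store → Prop}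
    (h : ∀ v : Fin n, R v (s.setNat r v)) :
    Simulates E out (.instr (.unif r m)) s 1 (PMF.uniformOfFintype (Fin n)) R := by
  intro K t₀ Ψ hΨ
  have hu : uniformBelow n = (PMF.uniformOfFintype (Fin n)).map Fin.val := by
    have hne : (Finset.range n).Nonempty := by simpa using NeZero.ne n
    ext x
    rw [uniformBelow, dif_pos hne, PMF.uniformOfFinset_apply, PMF.map_apply, tsum_fintype]
    by_cases hx : x < n
    · rw [Finset.sum_eq_single (⟨x, hx⟩ : Fin n)]
      · simp [hx]
      · intro b _ hb
        rw [if_neg]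
        rintro rfl
        exact hb rfl
      · simp
    · rw [Finset.sum_eq_zero]
      · simp [hx]
      · intro b _
        rw [if_neg]
        rintro rfl
        exact hx b.2
  rw [Nat.add_comm, run_instr]
  simp only [Instr.exec, hm, hu, PMF.bind_map, PMF.map_bind]
  congr 1
  funext v
  exact hΨ v _ (h v)

lemma simulates_flip (r p : ℕ) {R : Bool → Store → Prop}
    (h : ∀ b : Bool, R b (s.setNat r (if b then 1 else 0))) :
    Simulates E out (.instr (.flip r p)) s 1 (HardCore.coin (s.real p)) R := by
  intro K t₀ Ψ hΨ
  rw [Nat.add_comm, run_instr]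
  simp only [Instr.exec, PMF.bind_map, PMF.map_bind]
  congr 1
  funext b
  exact hΨ b _ (h b)

end Machine

end RealRAM

namespace RealRAM

/-! ### The annealing program and its invariants -/

/-- Adds to register 7 one if the vertex in register 4 is an occupied neighbour of the vertex in
register 5, and increments register 4. -/
def scanBody : Prog :=
  block [.edge 8 5 4, .load 9 4, .add 8 8 9, .sub 8 8 1, .add 7 7 8, .add 4 4 1]

/-- Counts the occupied neighbours of the vertex in register 5. -/
def scanProg : Prog := .loop (.natLt 4 0) scanBody

/-- One step of the Glauber dynamics. -/
def glauberProg : Prog :=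
  .seq (block [.rmul 11 11 8]) <| .seq (.instr (.unif 5 0)) <| .seq (.instr (.flip 6 10)) <|
    .seq (block [.const 4 0, .const 7 0]) <| .seq scanProg (block [.sub 6 6 7, .store 5 6])

/-- One stage of simulated annealing: the next fugacity is computed, and Glauber steps are made
until the real register 11, which is multiplied by register 8 in each step, is at most one. -/
def stageProg : Prog :=
  .seq (block [.add 3 3 1, .ofNat 9 3, .rmul 9 9 0, .rdiv 9 9 4, .radd 10 3 9, .rdiv 10 9 10,
    .radd 11 7 12]) (.loop (.realLt 3 11) glauberProg)

/-- Computation of the parameters. -/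
def setupProg : Prog :=
  block [.const 1 1, .add 2 0 0, .add 2 2 0, .add 10 2 2, .ofNat 3 1, .ofNat 4 2, .ofNat 5 10,
    .ofNat 6 0, .rmul 7 5 6, .rdiv 7 7 1, .radd 8 6 6, .radd 8 8 8, .rdiv 8 2 8, .rsub 8 3 8]

/-- Simulated annealing. -/
def annealProg : Prog := .seq setupProg (.loop (.natLt 3 2) stageProg)

/-- The store represents the set `X` at the `i`-th stage. -/
structure Represents (n : ℕ) (lam q r : ℝ) (i : ℕ) (X : Finset (Fin n)) (s : Store) : Prop where
  nat0 : s.nat 0 = n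
  nat1 : s.nat 1 = 1
  nat2 : s.nat 2 = 3 * n
  nat3 : s.nat 3 = i
  real0 : s.real 0 = lam
  real3 : s.real 3 = 1
  real4 : s.real 4 = ((3 * n : ℕ) : ℝ)
  real7 : s.real 7 = q
  real8 : s.real 8 = r
  real12 : s.real 12 = 0
  mem : ∀ v : Fin n, s.mem v = if v ∈ X then 1 else 0

/-- In addition, the insertion probability is `p`, and the loop variable has the value `x`. -/
structure InStage (n : ℕ) (lam q r : ℝ) (i : ℕ) (p x : ℝ) (X : Finset (Fin n)) (s : Store) : Prop
    extends Represents n lam q r i X s where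
  real10 : s.real 10 = p
  real11 : s.real 11 = x

/-! ### Correctness and exact running time of the program -/

section Anneal

variable {n : ℕ} {lam q r p x : ℝ} {i : ℕ} {γ : Type} {out : Config → γ}
  {G : SimpleGraph (Fin n)} {s : Store}

/-- The vertex `v` and the bit `b` are chosen, and the vertices below `u` are scanned for occupied
neighbours of `v`. -/
structure InScan (n : ℕ) (lam q r : ℝ) (i : ℕ) (p x : ℝ) (G : SimpleGraph (Fin n))
    (X : Finset (Fin n)) (v : Fin n) (b : Bool) (u : ℕ) (s : Store) : Prop
    extends InStage n lam q r i p x X s where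
  nat5 : s.nat 5 = v
  nat6 : s.nat 6 = if b then 1 else 0
  nat4 : s.nat 4 = u
  nat7 : s.nat 7 = 0 ↔ ∀ w : Fin n, (w : ℕ) < u → w ∈ X → ¬ G.Adj v w

/-- For bits `a` and `b`, the truncated difference `a + b - 1` is their conjunction. -/
lemma simulates_scanBody {X : Finset (Fin n)} {v : Fin n} {b : Bool} {u : ℕ} (hu : u < n)
    (h : InScan n lam q r i p x G X v b u s) :
    Simulates (edges G) out scanBody s 13 (PMF.pure ())
      (fun _ => InScan n lam q r i p x G X v b (u + 1)) := by
  refine simulates_block _ (by simp [Instr.IsDet]) () ?_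
  have hm := h.mem ⟨u, hu⟩
  have hE : edges G (s.nat 5) (s.nat 4) ↔ G.Adj v ⟨u, hu⟩ := by
    rw [h.nat5, h.nat4]
    simp [edges, hu]
  dsimp only at hm
  have h0 := h.nat0
  have h1 := h.nat1
  have h2 := h.nat2
  have h3 := h.nat3
  have h4 := h.nat4
  have h5 := h.nat5
  have h6 := h.nat6
  refine { nat0 := ?_, nat1 := ?_, nat2 := ?_, nat3 := ?_, real0 := h.real0, real3 := h.real3,
           real4 := h.real4, real7 := h.real7, real8 := h.real8, real12 := h.real12,
           mem := h.mem, real10 := h.real10, real11 := h.real11, nat5 := ?_, nat6 := ?_,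
           nat4 := ?_, nat7 := ?_ }
  all_goals simp [Instr.det, Store.setNat, Function.update, h0, h1, h2, h3, h4, h5, h6]
  rw [h.nat7, hm]
  constructor
  · rintro ⟨ha, hb⟩ w hw hX hadj
    rcases Nat.lt_or_eq_of_le hw with hlt | heq
    · exact ha w hlt hX hadj
    · have : w = ⟨u, hu⟩ := Fin.ext heq
      subst this
      simp [hX, if_pos (hE.mpr hadj)] at hb
  · intro ha
    refine ⟨fun w hw => ha w (by omega), ?_⟩
    have := ha ⟨u, hu⟩ (by simp)
    by_cases h₁ : (⟨u, hu⟩ : Fin n) ∈ X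
    · simp [h₁, if_neg (mt hE.mp (this h₁))]
    · simp only [h₁, if_false]
      split_ifs <;> simp

lemma simulates_scanProg {X : Finset (Fin n)} {v : Fin n} {b : Bool} (m : ℕ) :
    ∀ (s : Store) (u : ℕ), u + m = n → InScan n lam q r i p x G X v b u s →
    Simulates (edges G) out scanProg s (14 * m + 1) (PMF.pure ())
      (fun _ => InScan n lam q r i p x G X v b n) := by
  induction m with
  | zero =>
    intro s u hu h
    obtain rfl : u = n := by omega
    exact simulates_loop_of_not_holds (by simp [Test.holds, h.nat4, h.nat0]) () h
  | succ m ih =>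
    intro s u hu h
    have := simulates_loop_of_holds (b := .natLt 4 0)
      (by simp only [Test.holds, h.nat4, h.nat0]; omega)
      (simulates_scanBody (out := out) (by omega) h) (fun _ s' h' => ih s' (u + 1) (by omega) h')
    rw [PMF.pure_bind] at this
    exact this.of_eq (by ring)

lemma simulates_glauberProg [NeZero n] (X : HardCore.IndepSets G) {f : ℝ}
    (h : InStage n lam q r i (f / (1 + f)) x X.1 s) :
    Simulates (edges G) out glauberProg s (14 * n + 21) (HardCore.glauberStep G f X)
      (fun Y => InStage n lam q r i (f / (1 + f)) (x * r) Y.1) := by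
  have scaled : Simulates (edges G) out (block [.rmul 11 11 8]) s 3 (PMF.pure ())
      (fun _ => InStage n lam q r i (f / (1 + f)) (x * r) X.1) := by
    refine simulates_block _ (by simp [Instr.IsDet]) () ?_
    have h8 := h.real8
    have h11 := h.real11
    refine { nat0 := h.nat0, nat1 := h.nat1, nat2 := h.nat2, nat3 := h.nat3, real0 := ?_,
             real3 := ?_, real4 := ?_, real7 := ?_, real8 := ?_, real12 := ?_,
             mem := h.mem, real10 := ?_, real11 := ?_ }
    all_goals simp [Instr.det, Store.setReal, Function.update, h.real0, h.real3, h.real4, h.real7,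
      h.real8, h.real10, h.real11, h.real12]
  -- The truncated difference of the bit and the neighbour count is 1 exactly if insertion is tried
  -- and succeeds. Writing 0 in a rejected insertion is correct by `mem_update`.
  have last (v : Fin n) (b : Bool) (s : Store)
      (h : InScan n lam q r i (f / (1 + f)) (x * r) G X.1 v b n s) :
      Simulates (edges G) out (block [.sub 6 6 7, .store 5 6]) s 5
        (PMF.pure (HardCore.update G X v b))
        (fun Y => InStage n lam q r i (f / (1 + f)) (x * r) Y.1) := by
    refine simulates_block _ (by simp [Instr.IsDet]) _ ?_
    refine { nat0 := ?_, nat1 := ?_, nat2 := ?_, nat3 := ?_, real0 := h.real0, real3 := h.real3,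
             real4 := h.real4, real7 := h.real7, real8 := h.real8, real12 := h.real12,
             mem := ?_, real10 := h.real10, real11 := h.real11 }
    · simp [Instr.det, Store.setNat, Store.setMem, Function.update, h.nat0]
    · simp [Instr.det, Store.setNat, Store.setMem, Function.update, h.nat1]
    · simp [Instr.det, Store.setNat, Store.setMem, Function.update, h.nat2]
    · simp [Instr.det, Store.setNat, Store.setMem, Function.update, h.nat3]
    · intro u
      have h7 := h.nat7
      simp only [Fin.is_lt, forall_const] at h7
      have hmu := HardCore.mem_update G X v u b
      simp only [Instr.det, Store.setNat, Store.setMem, Function.update, h.nat5, h.nat6,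
        List.foldl_cons, List.foldl_nil]
      by_cases huv : u = v
      · subst huv
        rw [if_pos rfl, ← h7] at hmu
        by_cases hm : u ∈ (HardCore.update G X u b).1
        · rw [if_pos hm]
          obtain ⟨rfl, h0⟩ := hmu.mp hm
          simp [h0]
        · rw [if_neg hm]
          have := mt hmu.mpr hm
          cases b
          · simp
          · have h0 : s.nat 7 ≠ 0 := by simpa using this
            simp [Nat.one_le_iff_ne_zero.mpr h0]
      · have : (u : ℕ) ≠ v := fun e => huv (Fin.ext e)
        rw [if_neg huv] at hmu
        by_cases hm : u ∈ (HardCore.update G X v b).1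
        · rw [if_pos hm]
          simp [this, h.mem, hmu.mp hm]
        · rw [if_neg hm]
          simp [this, h.mem, mt hmu.mpr hm]
  have main := scaled.seq (Q := .seq (.instr (.unif 5 0)) <| .seq (.instr (.flip 6 10)) <|
      .seq (block [.const 4 0, .const 7 0]) <| .seq scanProg (block [.sub 6 6 7, .store 5 6]))
    (t' := 14 * n + 17) (ρ' := fun _ => HardCore.glauberStep G f X)
    (R' := fun Y => InStage n lam q r i (f / (1 + f)) (x * r) Y.1) (fun _ s₁ h₁ => by
    have := (simulates_unif (E := edges G) (out := out) (s := s₁) (n := n) 5 0 h₁.nat0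
      (R := fun v s => InStage n lam q r i (f / (1 + f)) (x * r) X.1 s ∧ s.nat 5 = v)
      (fun v => ⟨by
        refine { nat0 := ?_, nat1 := ?_, nat2 := ?_, nat3 := ?_, real0 := h₁.real0,
                 real3 := h₁.real3, real4 := h₁.real4, real7 := h₁.real7, real8 := h₁.real8,
                 real12 := h₁.real12, mem := h₁.mem, real10 := h₁.real10, real11 := h₁.real11 }
        all_goals simp [Store.setNat, Function.update, h₁.nat0, h₁.nat1, h₁.nat2, h₁.nat3],
        by simp [Store.setNat]⟩)).seq (Q := .seq (.instr (.flip 6 10)) <|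
          .seq (block [.const 4 0, .const 7 0]) <| .seq scanProg (block [.sub 6 6 7, .store 5 6]))
        (t' := 14 * n + 15)
        (ρ' := fun v => (HardCore.coin (f / (1 + f))).bind fun b =>
          PMF.pure (HardCore.update G X v b))
        (R' := fun Y => InStage n lam q r i (f / (1 + f)) (x * r) Y.1) (fun v s₂ h₂ => by
          obtain ⟨h₂, h5⟩ := h₂
          have := (simulates_flip (E := edges G) (out := out) (s := s₂) 6 10
            (R := fun b s => InStage n lam q r i (f / (1 + f)) (x * r) X.1 s ∧ s.nat 5 = v ∧
              s.nat 6 = if b then 1 else 0) (fun b => ⟨by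
              refine { nat0 := ?_, nat1 := ?_, nat2 := ?_, nat3 := ?_, real0 := h₂.real0,
                       real3 := h₂.real3, real4 := h₂.real4, real7 := h₂.real7,
                       real8 := h₂.real8, real12 := h₂.real12, mem := h₂.mem,
                       real10 := h₂.real10, real11 := h₂.real11 }
              all_goals simp [Store.setNat, Function.update, h₂.nat0, h₂.nat1, h₂.nat2, h₂.nat3],
              by simp [Store.setNat, Function.update, h5], by simp [Store.setNat]⟩)).seq
            (Q := .seq (block [.const 4 0, .const 7 0]) <| .seq scanProg
              (block [.sub 6 6 7, .store 5 6])) (t' := 14 * n + 13)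
            (ρ' := fun b => PMF.pure (HardCore.update G X v b))
            (R' := fun Y => InStage n lam q r i (f / (1 + f)) (x * r) Y.1)
            (fun b s₃ h₃ => by
              obtain ⟨h₃, h5, h6⟩ := h₃
              have hb : Simulates (edges G) out (block [.const 4 0, .const 7 0]) s₃ 5
                  (PMF.pure ())
                  (fun _ => InScan n lam q r i (f / (1 + f)) (x * r) G X.1 v b 0) := by
                refine simulates_block _ (by simp [Instr.IsDet]) () ?_
                refine { nat0 := ?_, nat1 := ?_, nat2 := ?_, nat3 := ?_, real0 := h₃.real0,
                         real3 := h₃.real3, real4 := h₃.real4, real7 := h₃.real7,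
                         real8 := h₃.real8, real12 := h₃.real12, mem := h₃.mem,
                         real10 := h₃.real10, real11 := h₃.real11, nat4 := ?_, nat5 := ?_,
                         nat6 := ?_, nat7 := ?_ }
                all_goals simp [Instr.det, Store.setNat, Function.update, h₃.nat0, h₃.nat1,
                  h₃.nat2, h₃.nat3, h5, h6]
              have := hb.seq (fun _ s₄ h₄ =>
                (simulates_scanProg n s₄ 0 (by omega) h₄).seq (fun _ s₅ h₅ => last v b s₅ h₅))
              simp only [PMF.pure_bind] at this
              exact this.of_eq (by ring))
          rw [h₂.real10] at this
          exact this.of_eq (by ring))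
    exact this.of_eq (by ring))
  rw [PMF.pure_bind] at main
  exact main.of_eq (by ring)

/-- The hypotheses say that `T` is the first exponent at which the loop variable is at most one, so
the number of iterations involves no randomness. -/
lemma simulates_glauberLoop [NeZero n] {f : ℝ} (T : ℕ) :
    ∀ (s : Store) (x : ℝ) (X : HardCore.IndepSets G), (∀ j < T, 1 < x * r ^ j) → x * r ^ T ≤ 1 →
    InStage n lam q r i (f / (1 + f)) x X.1 s →
    Simulates (edges G) out (.loop (.realLt 3 11) glauberProg) s ((14 * n + 22) * T + 1)
      (HardCore.glauber G f T X) (fun Y => Represents n lam q r i Y.1) := by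
  induction T with
  | zero =>
    intro s x X _ hx h
    refine simulates_loop_of_not_holds ?_ X h.toRepresents
    simp only [Test.holds, h.real3, h.real11]
    simpa using hx
  | succ T ih =>
    intro s x X hlt hx h
    have := simulates_loop_of_holds (b := .realLt 3 11)
      (by simp only [Test.holds, h.real3, h.real11]; simpa using hlt 0 (by omega))
      (simulates_glauberProg (out := out) X h) (fun Y s' h' => ih s' (x * r) Y
        (fun j hj => by
          have := hlt (j + 1) (by omega)
          rwa [pow_succ', ← mul_assoc] at this)
        (by rwa [pow_succ', ← mul_assoc] at hx) h')
    rw [HardCore.glauber]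
    exact this.of_eq (by ring)

lemma simulates_stageProg [NeZero n] {T : ℕ} (X : HardCore.IndepSets G)
    (hlt : ∀ j < T, 1 < q * r ^ j) (hq : q * r ^ T ≤ 1) (h : Represents n lam q r i X.1 s) :
    Simulates (edges G) out stageProg s ((14 * n + 22) * T + 17)
      (HardCore.glauber G (((i + 1 : ℕ) : ℝ) * lam / ((3 * n : ℕ) : ℝ)) T X)
      (fun Y => Represents n lam q r (i + 1) Y.1) := by
  -- Real register 12 is zero, so the last addition resets the loop variable to `q`.
  have first : Simulates (edges G) out (block [.add 3 3 1, .ofNat 9 3, .rmul 9 9 0, .rdiv 9 9 4,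
      .radd 10 3 9, .rdiv 10 9 10, .radd 11 7 12]) s 15 (PMF.pure ())
      (fun _ => InStage n lam q r (i + 1) ((((i + 1 : ℕ) : ℝ) * lam / ((3 * n : ℕ) : ℝ)) /
        (1 + (((i + 1 : ℕ) : ℝ) * lam / ((3 * n : ℕ) : ℝ)))) q X.1) := by
    refine simulates_block _ (by simp [Instr.IsDet]) () ?_
    refine { nat0 := ?_, nat1 := ?_, nat2 := ?_, nat3 := ?_, real0 := ?_,
             real3 := ?_, real4 := ?_, real7 := ?_, real8 := ?_, real12 := ?_,
             mem := h.mem, real10 := ?_, real11 := ?_ }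
    all_goals simp [Instr.det, Store.setReal, Store.setNat, Function.update, h.real0, h.real3,
      h.real4, h.real7, h.real8, h.real12, h.nat0, h.nat1, h.nat2, h.nat3]
  have := first.seq fun _ s' h' => simulates_glauberLoop T s' q X hlt hq h'
  rw [PMF.pure_bind] at this
  exact this.of_eq (by ring)

lemma simulates_setupProg [NeZero n] {δ ε : ℝ} :
    Simulates (edges G) out setupProg (initStore n lam δ ε) 29 (PMF.pure (HardCore.emptySet G))
      (fun Y => Represents n lam (6 * n * n / δ) (1 - ε / (4 * n)) 0 Y.1) := by
  refine simulates_block _ (by simp [Instr.IsDet]) _ ?_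
  refine { nat0 := ?_, nat1 := ?_, nat2 := ?_, nat3 := ?_, real0 := ?_,
           real3 := ?_, real4 := ?_, real7 := ?_, real8 := ?_, real12 := ?_, mem := ?_ }
  all_goals simp [Instr.det, Store.setReal, Store.setNat, Function.update, initStore,
    HardCore.emptySet]
  all_goals ring

/-- Each further stage is absorbed into the continuation `Ψ`, matching the recursion of `annealing`
on its last stage. -/
lemma run_annealProg [NeZero n] {δ ε : ℝ} {T : ℕ}
    (hlt : ∀ j < T, 1 < 6 * n * n / δ * (1 - ε / (4 * n)) ^ j)
    (hq : 6 * n * n / δ * (1 - ε / (4 * n)) ^ T ≤ 1) (i : ℕ) (hi : i ≤ 3 * n) (t' : ℕ)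
    (Ψ : HardCore.IndepSets G → PMF γ)
    (hΨ : ∀ (Y : HardCore.IndepSets G) (s' : Store),
      Represents n lam (6 * n * n / δ) (1 - ε / (4 * n)) i Y.1 s' →
      (run (edges G) t' ([.loop (.natLt 3 2) stageProg], s')).map out = Ψ Y) :
    (run (edges G) (30 + i * ((14 * n + 22) * T + 18) + t') ([annealProg],
      initStore n lam δ ε)).map out =
      (HardCore.annealing G (fun j => (j : ℝ) * lam / ((3 * n : ℕ) : ℝ)) (fun _ => T) i).bind
        Ψ := by
  induction i generalizing t' Ψ with
  | zero =>
    rw [show 30 + 0 * ((14 * n + 22) * T + 18) + t' = (29 + t') + 1 by omega, annealProg, run_seq]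
    exact simulates_setupProg _ _ _ hΨ
  | succ i ih =>
    rw [show 30 + (i + 1) * ((14 * n + 22) * T + 18) + t' = 30 + i * ((14 * n + 22) * T + 18) +
      (((14 * n + 22) * T + 17 + t') + 1) by ring, HardCore.annealing, PMF.bind_bind]
    refine ih (by omega) _ _ fun Y s' h => ?_
    rw [run_loop_of_holds _ _ _ _ _ (by simp only [Test.holds, h.nat3, h.nat2]; omega)]
    exact simulates_stageProg Y hlt hq h _ _ _ hΨ

lemma outputAfter_annealProg [NeZero n] {δ ε : ℝ} {T : ℕ}
    (hlt : ∀ j < T, 1 < 6 * n * n / δ * (1 - ε / (4 * n)) ^ j)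
    (hq : 6 * n * n / δ * (1 - ε / (4 * n)) ^ T ≤ 1) :
    outputAfter annealProg (30 + 3 * n * ((14 * n + 22) * T + 18) + 1) G lam δ ε =
      (HardCore.annealing G (fun j => (j : ℝ) * lam / ((3 * n : ℕ) : ℝ)) (fun _ => T) (3 * n)).map
        fun X => some X.1 := by
  rw [outputAfter, run_annealProg hlt hq (3 * n) le_rfl 1 (fun X => PMF.pure (some X.1)),
    ← PMF.bind_pure_comp]
  · rfl
  · intro Y s' h
    rw [run_loop_of_not_holds 0 _ _ _ _ (by simp [Test.holds, h.nat3, h.nat2]), run,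
      PMF.pure_map, output]
    congr 2
    ext v
    simp [h.mem v]

end Anneal

end RealRAM

/-! ### Choice of constants and conclusion -/

namespace HardCore

/-- Take the least such `T`. Minimality at `T - 1` and `log r ≤ r - 1` give the bound; the
nonnegative `B` covers the case `log q < 0`. -/
lemma exists_step_count {q r : ℝ} (hr0 : 0 < r) (hr1 : r < 1) (hq : 0 < q) :
    ∃ T : ℕ, (∀ j < T, 1 < q * r ^ j) ∧ q * r ^ T ≤ 1 ∧
      ∀ B : ℝ, 0 ≤ B → Real.log q ≤ B → (T : ℝ) ≤ 1 + B / (1 - r) := by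
  classical
  have hex : ∃ T : ℕ, q * r ^ T ≤ 1 := by
    obtain ⟨T, hT⟩ := exists_pow_lt_of_lt_one (inv_pos.mpr hq) hr1
    refine ⟨T, ?_⟩
    have := mul_lt_mul_of_pos_left hT hq
    rw [mul_inv_cancel₀ hq.ne'] at this
    exact this.le
  refine ⟨Nat.find hex, fun j hj => not_le.mp (Nat.find_min hex hj), Nat.find_spec hex, ?_⟩
  intro B hB0 hB
  have h1r : 0 < 1 - r := by linarith
  rcases Nat.eq_zero_or_pos (Nat.find hex) with h0 | hpos
  · rw [h0]
    have : 0 ≤ B / (1 - r) := by positivity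
    simp only [Nat.cast_zero]
    linarith
  · obtain ⟨m, hm⟩ := Nat.exists_eq_succ_of_ne_zero hpos.ne'
    have hlt : 1 < q * r ^ m := not_le.mp (Nat.find_min hex (by omega))
    have hl := Real.log_pos hlt
    rw [Real.log_mul hq.ne' (pow_pos hr0 m).ne', Real.log_pow] at hl
    have hlr := Real.log_le_sub_one_of_pos hr0
    have hm0 : (0 : ℝ) ≤ m := Nat.cast_nonneg _
    have : (m : ℝ) ≤ B / (1 - r) := by
      rw [le_div_iff₀ h1r]
      nlinarith
    rw [hm]
    push_cast
    linarith

/-- Since `L ≥ 1/2`, the choice of `C` gives `aΔ ≥ 4L + Q`: four powers of `δ / n` cancel `n ^ 4`,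
and `exp(-Q)` cancels `96K/ε`. -/
lemma failure_le {n δ ε K a C Δ : ℝ} (hn : 2 ≤ n) (hδ : 0 < δ) (hδ1 : δ < 1) (hε : 0 < ε)
    (hK : 0 < K) (ha : 0 < a) (hQ : 0 ≤ Real.log (96 * K / ε))
    (hC : (4 + 2 * Real.log (96 * K / ε)) / a ≤ C) (hΔ : C * Real.log (n / δ) ≤ Δ) :
    96 * n ^ 4 * K * Real.exp (-(a * Δ)) / ε ≤ δ := by
  set Q := Real.log (96 * K / ε) with hQdef
  set L := Real.log (n / δ) with hL
  have hn0 : 0 < n := by linarith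
  have hnd : 2 ≤ n / δ := by rw [le_div_iff₀ hδ]; nlinarith
  have hL2 : 1 / 2 ≤ L := by
    have := Real.log_le_log (by norm_num) hnd
    have := Real.log_two_gt_d9
    linarith
  have haC : 4 + 2 * Q ≤ a * C := by
    rw [div_le_iff₀ ha] at hC
    linarith
  have haΔ : 4 * L + Q ≤ a * Δ := by
    have h1 := mul_le_mul_of_nonneg_left hΔ ha.le
    have h2 := mul_le_mul_of_nonneg_right haC (by linarith : 0 ≤ L)
    nlinarith
  have hexpL : Real.exp (-L) = δ / n := by
    rw [Real.exp_neg, hL, Real.exp_log (by positivity), inv_div]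
  have hexpQ : Real.exp (-Q) = ε / (96 * K) := by
    rw [Real.exp_neg, hQdef, Real.exp_log (by positivity), inv_div]
  have he : Real.exp (-(a * Δ)) ≤ (δ / n) ^ 4 * (ε / (96 * K)) := by
    rw [← hexpL, ← hexpQ, ← Real.exp_nat_mul, ← Real.exp_add]
    refine Real.exp_le_exp.mpr ?_
    push_cast
    linarith
  have hδ4 : δ ^ 4 ≤ δ := pow_le_of_le_one hδ.le hδ1.le (by norm_num)
  calc 96 * n ^ 4 * K * Real.exp (-(a * Δ)) / ε
      ≤ 96 * n ^ 4 * K * ((δ / n) ^ 4 * (ε / (96 * K))) / ε := by gcongr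
    _ = δ ^ 4 := by field_simp
    _ ≤ δ := hδ4

end HardCore

/-- There are a program `P` and a polynomial `p` (both independent of all parameters) such that
for every `ε > 0` there is `C > 0` with the following property for all `δ`, `G`, `lam`: on input
`(G, lam, δ, ε)` the program halts with certainty within `p(n, 1/ε, log⁺(1/δ))` steps; its output
has exactly the law of simulated annealing by Glauber dynamics along an increasing sequence of
fugacities from `0` to `lam`, in particular it is an independent set; and this law is within
total variation distance `δ` of the Gibbs distribution at fugacity `lam`. -/
theorem theorem1p5 :
    ∃ (P : RealRAM.Prog) (p : MvPolynomial (Fin 3) ℝ),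
      ∀ ε : ℝ, 0 < ε → ∃ C : ℝ, 0 < C ∧
        ∀ δ : ℝ, 0 < δ →
        ∀ (n : ℕ) [NeZero n] (G : SimpleGraph (Fin n)) [DecidableRel G.Adj] (Δ : ℕ),
          G.IsRegularOfDegree Δ → 6 ≤ G.egirth → C * Real.log (n / δ) ≤ Δ →
        ∀ lam : ℝ, 0 < lam → lam ≤ (1 - ε) * Real.exp 1 / Δ →
          ∃ (k : ℕ) (fug : ℕ → ℝ) (T : ℕ → ℕ) (t : ℕ),
            fug 0 = 0 ∧ (∀ i < k, fug i < fug (i + 1)) ∧ fug k = lam ∧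
            (t : ℝ) ≤ MvPolynomial.eval ![(n : ℝ), 1 / ε, Real.posLog (1 / δ)] p ∧
            RealRAM.outputAfter P t G lam δ ε =
              (HardCore.annealing G fug T k).map (fun X => some X.1) ∧
            HardCore.tvDist (fun X => (HardCore.annealing G fug T k X).toReal)
              (HardCore.gibbs G lam) ≤ δ := by
  -- The exact running time, with `T` replaced by its bound `1 + (4n/ε)(6n² + log⁺(1/δ))`.
  refine ⟨RealRAM.annealProg, 31 + 3 * .X 0 * ((14 * .X 0 + 22) *
    (1 + 4 * .X 0 * .X 1 * (6 * .X 0 * .X 0 + .X 2)) + 18), fun ε hε => ?_⟩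
  rcases le_or_gt 1 ε with hε1 | hε1
  · refine ⟨1, one_pos, fun δ _ n _ G _ Δ _ _ _ lam hlam hle => ?_⟩
    have : (1 - ε) * Real.exp 1 / Δ ≤ 0 :=
      div_nonpos_of_nonpos_of_nonneg
        (mul_nonpos_of_nonpos_of_nonneg (by linarith) (Real.exp_pos _).le) (Nat.cast_nonneg _)
    linarith
  obtain ⟨κ, hκ, hgap⟩ := HardCore.exists_gap hε hε1
  obtain ⟨η, hη, hη7, hηκ⟩ : ∃ η : ℝ, 0 < η ∧ 7 * η ≤ 1 ∧ 48 * η < κ :=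
    ⟨min (1 / 7) (κ / 49), by positivity, by linarith [min_le_left (1 / 7) (κ / 49)],
      by linarith [min_le_right (1 / 7) (κ / 49)]⟩
  set K : ℝ := 2 + Real.exp 6 with hK
  have hK2 : 2 ≤ K := by linarith [Real.exp_pos 6]
  have hQ : 0 ≤ Real.log (96 * K / ε) := by
    refine Real.log_nonneg ?_
    rw [le_div_iff₀ hε]
    linarith
  -- The first summand gives `lam ≤ η`, since `log(n/δ) ≥ 1/2` when `δ < 1`; the second is for
  -- `failure_le`.
  refine ⟨6 / η + (4 + 2 * Real.log (96 * K / ε)) / (η ^ 2 / 4), by positivity, ?_⟩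
  intro δ hδ n _ G _ Δ hreg hg hΔ lam hlam hle
  have hΔ0 : Δ ≠ 0 := by
    -- Division by zero gives 0, so `Δ = 0` would force `lam ≤ 0`.
    rintro rfl
    simp at hle
    linarith
  have hΔpos : (0 : ℝ) < Δ := by exact_mod_cast Nat.pos_of_ne_zero hΔ0
  have hn2 : 2 ≤ n := by
    have h1 := G.degree_lt_card_verts (0 : Fin n)
    rw [hreg, Fintype.card_fin] at h1
    omega
  have hn2' : (2 : ℝ) ≤ n := by exact_mod_cast hn2
  have hn0 : (0 : ℝ) < n := by linarith
  have hc : lam * Δ ≤ (1 - ε) * Real.exp 1 := (le_div_iff₀ hΔpos).mp hle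
  have hc3 : lam * Δ ≤ 3 := by
    have := Real.exp_one_lt_d9
    have := Real.exp_pos 1
    nlinarith
  have hlam3 : lam ≤ 3 := by
    have : (1 : ℝ) ≤ Δ := by exact_mod_cast Nat.pos_of_ne_zero hΔ0
    nlinarith
  have hr : ε / (4 * n) < 1 := by rw [div_lt_one (by linarith)]; linarith
  have hr' : 0 < ε / (4 * n) := by positivity
  obtain ⟨T, hT₁, hT₂, hT₃⟩ := HardCore.exists_step_count (q := 6 * n * n / δ)
    (r := 1 - ε / (4 * n)) (by linarith) (by linarith) (by positivity)
  have hk : ((3 * n : ℕ) : ℝ) * lam / ((3 * n : ℕ) : ℝ) = lam := by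
    have : ((3 * n : ℕ) : ℝ) ≠ 0 := by exact_mod_cast (by omega : 3 * n ≠ 0)
    field_simp
  -- As `lam ≤ 3`, `3n` stages make each fugacity increment at most `1/n`, as the warm start
  -- requires.
  refine ⟨3 * n, fun j => (j : ℝ) * lam / ((3 * n : ℕ) : ℝ), fun _ => T,
    30 + 3 * n * ((14 * n + 22) * T + 18) + 1, by simp, ?_, hk, ?_,
    RealRAM.outputAfter_annealProg hT₁ hT₂, ?_⟩
  · intro i _
    have : (0 : ℝ) < ((3 * n : ℕ) : ℝ) := by exact_mod_cast (by omega : 0 < 3 * n)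
    refine div_lt_div_of_pos_right (mul_lt_mul_of_pos_right ?_ hlam) this
    push_cast
    linarith
  · have hpl : 0 ≤ Real.posLog (1 / δ) := Real.posLog_nonneg
    have hlog : Real.log (6 * n * n / δ) ≤ 6 * n * n + Real.posLog (1 / δ) := by
      rw [div_eq_mul_one_div, Real.log_mul (by positivity) (by positivity)]
      have h1 := Real.log_le_sub_one_of_pos (show (0 : ℝ) < 6 * n * n by positivity)
      have h2 : Real.log (1 / δ) ≤ Real.posLog (1 / δ) := le_max_right _ _
      linarith
    have hTb := hT₃ _ (by positivity) hlog
    have e : (6 * n * n + Real.posLog (1 / δ)) / (1 - (1 - ε / (4 * n))) =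
        4 * n * (1 / ε) * (6 * n * n + Real.posLog (1 / δ)) := by
      rw [sub_sub_cancel]
      field_simp
    rw [e] at hTb
    simp only [map_add, map_mul, map_one, map_ofNat, MvPolynomial.eval_X, Matrix.cons_val_zero,
      Matrix.cons_val_one, Matrix.cons_val]
    push_cast
    have := mul_le_mul_of_nonneg_left hTb (by positivity : (0 : ℝ) ≤ 3 * n * (14 * n + 22))
    linarith
  · rcases le_or_gt 1 δ with hδ1 | hδ1
    · have := (HardCore.testClose_one (HardCore.annealing G
        (fun j => (j : ℝ) * lam / ((3 * n : ℕ) : ℝ)) (fun _ => T) (3 * n))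
        (HardCore.gibbsPMF G lam hlam.le)).tvDist_le
      simp_rw [HardCore.gibbsPMF_toReal] at this
      exact this.trans hδ1
    · have hfail := HardCore.failure_le hn2' hδ hδ1 hε (by linarith : 0 < K)
        (by positivity : 0 < η ^ 2 / 4) hQ (le_add_of_nonneg_left (by positivity)) hΔ
      have hL2 : 1 / 2 ≤ Real.log (n / δ) := by
        have hnd : (2 : ℝ) ≤ n / δ := by rw [le_div_iff₀ hδ]; nlinarith
        have := Real.log_le_log (by norm_num) hnd
        have := Real.log_two_gt_d9
        linarith
      have hΔη : 3 / η ≤ Δ := by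
        refine le_trans ?_ hΔ
        have h1 : 6 / η ≤ 6 / η + (4 + 2 * Real.log (96 * K / ε)) / (η ^ 2 / 4) :=
          le_add_of_nonneg_right (by positivity)
        have h2 : 6 / η * (1 / 2) ≤ (6 / η + (4 + 2 * Real.log (96 * K / ε)) / (η ^ 2 / 4)) *
            Real.log (n / δ) := mul_le_mul h1 hL2 (by norm_num) (by positivity)
        refine le_trans (le_of_eq ?_) h2
        ring
      have hlamη : lam ≤ η := by
        rw [div_le_iff₀ hη] at hΔη
        by_contra hcon
        nlinarith
      have close := HardCore.testClose_annealing hg hreg hε hε1 hgap hη hη7 hηκ hlam hlamη hc T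
        (3 * n) (by rw [Fintype.card_fin]; push_cast; nlinarith) (by omega) (3 * n) le_rfl
      have tv := close.tvDist_le
      simp_rw [HardCore.gibbsPMF_toReal] at tv
      rw [hk, Fintype.card_fin] at tv
      refine tv.trans ?_
      -- The start value `6n²/δ` is chosen so that the mixing errors of all `3n` stages sum to at
      -- most `δ/2`.
      have hmix : 3 * n * (n * (1 - ε / (4 * n)) ^ T) ≤ δ / 2 := by
        rw [div_mul_eq_mul_div, div_le_one hδ] at hT₂
        linarith
      have hsplit : ((3 * n : ℕ) : ℝ) * (n * (1 - ε / (4 * n)) ^ T +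
          16 * (n : ℝ) ^ 2 * (n * (K * Real.exp (-(η ^ 2 / 4 * Δ)))) / ε) =
          3 * n * (n * (1 - ε / (4 * n)) ^ T) +
          (96 * (n : ℝ) ^ 4 * K * Real.exp (-(η ^ 2 / 4 * Δ)) / ε) / 2 := by
        push_cast
        ring
      rw [hsplit]
      linarith
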